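/- Let $G$ be a countable discrete Abelian group that has an element of infinite order, and let $k\ge 1$ be an integer. For a measure preserving action $T=(T_g)_{g\in G}$ of $G$ on a $\sigma$-finite measure space $(X,\mu)$, write $T^{-1}:=(T_{-g})_{g\in G}$; products of $G$-actions are the diagonal ones, $S\times R:=(S_g\times R_g)_{g\in G}$, with the product measure. A $G$-action is conservative if for each measurable set $B$ of positive measure there is $g\ne 0$ such that $T_gB\cap B$ has positive measure. $T$ has ergodic index $k$ if $T\times\cdots\times T$ ($k$ times) is ergodic but $T\times\cdots\times T$ ($k+1$ times) is not. $T$ is mixing (of zero type) if $\lim_{g\to\infty}\mu(T_gA\cap A)=0$ for each measurable set $A$ of finite measure. $T$ is of funny rank one if there are finite subsets $F_n\subset G$ and measurable sets $A_n\subset X$ of finite measure, $n\in\mathbb N$, such that $T_gA_n\cap T_hA_n=\emptyset$ whenever $g\ne h$ are in $F_n$, and for each measurable $B$ with $\mu(B)<\infty$ we have $\min_{S\subset F_n}\mu\big(B\,\triangle\,\bigcup_{g\in S}T_gA_n\big)\to 0$ as $n\to\infty$. If $G=\mathbb Z^d$ and all $F_n$ can be chosen to be cubes $\prod_{i=1}^d\{a_i,a_i+1,\dots,a_i+L\}$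 ($a\in\mathbb Z^d$, $L\ge 0$), then $T$ is of rank one. **Theorem.** There is a mixing (zero type) funny rank-one measure preserving action $T$ of $G$ on an infinite $\sigma$-finite standard measure space such that $T$ has ergodic index $k$, the product $T\times\cdots\times T$ ($k+1$ times) is conservative, and the product $T\times\cdots\times T$ ($k+2$ times) is not conservative. Moreover, for this $T$, the $G$-action $$\underbrace{T\times\cdots\times T}_{m\text{ times}}\times\underbrace{T^{-1}\times\cdots\times T^{-1}}_{k-m\text{ times}}$$ is ergodic for every $m\in\{0,1,\dots,k-1\}$. Furthermore, if $G=\mathbb Z^d$ for some $d>0$, then $T$ with all these properties can be chosen to be of rank one. -/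

import Mathlib

open MeasureTheory Filter Topology Set

namespace IMP

section Actions

variable {G X ι : Type*} [AddCommGroup G]

/-- The transformation `T_g` of an action `T = (T_g)_{g ∈ G}` of `G` on `X`. -/
def act (T : AddAction G X) (g : G) : X → X := fun x => T.toVAdd.vadd g x

theorem act_zero (T : AddAction G X) (x : X) : act T 0 x = x :=
  letI := T
  zero_vadd G x

theorem act_add (T : AddAction G X) (g h : G) (x : X) :
    act T (g + h) x = act T g (act T h x) :=
  letI := T
  add_vadd g h x

/-- The inverse action `T⁻¹ = (T_{-g})_{g ∈ G}` (an action since `G` is Abelian). -/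
def invAction (T : AddAction G X) : AddAction G X where
  vadd g x := act T (-g) x
  zero_vadd x := by
    change act T (-0) x = x
    rw [neg_zero, act_zero]
  add_vadd g h x := by
    change act T (-(g + h)) x = act T (-g) (act T (-h) x)
    rw [neg_add, act_add]

/-- The product action `(∏ᵢ (T i)_g)_{g ∈ G}` of the same group `G` on `∏ᵢ X`:
`g` acts on all the coordinates simultaneously. -/
def prodAction (T : ι → AddAction G X) : AddAction G (ι → X) where
  vadd g x := fun i => act (T i) g (x i)
  zero_vadd x := funext fun i => act_zero (T i) (x i)
  add_vadd g h x := funext fun i => act_add (T i) g h (x i)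

/-- The `k`-fold product `T × ⋯ × T`, an action of `G` on `X ^ k`. -/
def powAction (T : AddAction G X) (k : ℕ) : AddAction G (Fin k → X) :=
  prodAction fun _ => T

/-- `T × ⋯ × T × T⁻¹ × ⋯ × T⁻¹` with `k` factors, the first `m` of which are `T` and
the remaining `k - m` of which are `T⁻¹` (for `m ≤ k`). -/
def mixedAction (T : AddAction G X) (k m : ℕ) : AddAction G (Fin k → X) :=
  prodAction fun i => if (i : ℕ) < m then T else invAction T

variable [MeasurableSpace X]

/-- The product measure `μ ^ k` on `X ^ k`. -/
noncomputable def powMeasure (μ : Measure X) (k : ℕ) : Measure (Fin k → X) :=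
  Measure.pi fun _ => μ

/-- `T` is a (measurable) measure preserving action on `(X, μ)`. -/
def IsMeasurePreserving (T : AddAction G X) (μ : Measure X) : Prop :=
  ∀ g : G, MeasurePreserving (act T g) μ μ

/-- Ergodicity of a measure preserving action (Mathlib's notion): every measurable set that is
invariant mod `μ` under all `T_g` is null or conull. -/
def IsErgodic (T : AddAction G X) (μ : Measure X) : Prop :=
  @ErgodicVAdd G X T.toVAdd _ μ

/-- Conservativity: there is no wandering set of positive measure, i.e. for each measurable `B`
of positive measure there is `g ≠ 0` with `μ (T_g B ∩ B) > 0`. -/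
def IsConservative (T : AddAction G X) (μ : Measure X) : Prop :=
  ∀ B : Set X, MeasurableSet B → 0 < μ B → ∃ g : G, g ≠ 0 ∧ 0 < μ (act T g '' B ∩ B)

/-- `T` has ergodic index `k`: the `k`-fold product is ergodic, the `(k+1)`-fold one is not. -/
def HasErgodicIndex (T : AddAction G X) (μ : Measure X) (k : ℕ) : Prop :=
  IsErgodic (powAction T k) (powMeasure μ k) ∧
    ¬ IsErgodic (powAction T (k + 1)) (powMeasure μ (k + 1))

/-- `T` is mixing (of zero type): `μ (T_g A ∩ A) → 0` as `g → ∞` in the discrete group `G`,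
for each measurable `A` of finite measure. -/
def IsZeroType (T : AddAction G X) (μ : Measure X) : Prop :=
  ∀ A : Set X, MeasurableSet A → μ A < ⊤ →
    Tendsto (fun g : G => μ (act T g '' A ∩ A)) cofinite (𝓝 0)

/-- `T` is of funny rank one along `(F n)`: there are measurable sets `A n` of finite measure such
that, for each `n`, the sets `T_g (A n)`, `g ∈ F n`, are pairwise disjoint, and the towers
`{T_g (A n) | g ∈ F n}` approximate the whole `σ`-algebra: for each measurable `B` of finite
measure and each `ε > 0`, for all large `n`, some union of levels of the `n`-th tower is `ε`-close
to `B`. -/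
def IsFunnyRankOneAlong (T : AddAction G X) (μ : Measure X) (F : ℕ → Finset G) : Prop :=
  ∃ A : ℕ → Set X,
    (∀ n, MeasurableSet (A n) ∧ μ (A n) < ⊤) ∧
    (∀ n, ∀ g ∈ F n, ∀ h ∈ F n, g ≠ h → Disjoint (act T g '' A n) (act T h '' A n)) ∧
    ∀ B : Set X, MeasurableSet B → μ B < ⊤ → ∀ ε : ENNReal, 0 < ε →
      ∀ᶠ n in atTop, ∃ S ⊆ F n, μ (symmDiff B (⋃ g ∈ S, act T g '' A n)) < ε

/-- `T` is of funny rank one. -/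
def IsFunnyRankOne (T : AddAction G X) (μ : Measure X) : Prop :=
  ∃ F : ℕ → Finset G, IsFunnyRankOneAlong T μ F

/-- A (nonempty) cube in `ℤ ^ d`: `∏ᵢ {aᵢ, aᵢ + 1, …, aᵢ + L}`, of the same side in each
direction. -/
def IsCube {d : ℕ} (F : Finset (Fin d → ℤ)) : Prop :=
  ∃ (a : Fin d → ℤ) (L : ℕ), F = Finset.Icc a (a + fun _ => (L : ℤ))

/-- A `ℤ ^ d`-action is of rank one if it is of funny rank one along a sequence of cubes. -/
def IsRankOne {d : ℕ} (T : AddAction (Fin d → ℤ) X) (μ : Measure X) : Prop :=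
  ∃ F : ℕ → Finset (Fin d → ℤ), (∀ n, IsCube (F n)) ∧ IsFunnyRankOneAlong T μ F

end Actions

end IMP

/-! The action is a `(C, F)`-action. A level of the `n`-th tower splits into `C.M n` sublevels of
equal measure, indexed by letters; a point of a level is an infinite sequence of independent uniform
letters, and `G` translates the partial sums of the displacements `C.e l j`. In a power of the
space, boxes split according to tuples of letters, called words here. All the dynamics depends on
which families of words have summable frequencies.

The numbers `M n` grow like `n ^ (1 / k)`, so that `M n ^ (-k)` has a divergent sum and `M n ^ (-(k
+ 1))` a convergent one. A bounded number of words per step therefore has non-summable frequency in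
the `k`-th power and summable frequency in the next one. The `M n` constant words have non-summable
frequency in the power `k + 1` and summable frequency in the power `k + 2`.

The letters form a Sidon set relative to the differences of `F n` (`IsSparse`), except for `k`
planted relations `e (k + i) = e i + g - u i`. Through them one diagonal translation by `g` matches
boxes that differ by the vector `u n`, and each vector of `G ^ k` is used along a non-summable set
of times. An invariant set that is dense in one box and sparse in another is then excluded by
averaging along the tree of boxes (`le_half_of_sum_le`). The relations survive a change of sign in
any coordinate, so factors `T⁻¹` are allowed. Likewise the difference of two letters carries one
constant word to another, and a wandering set in the power `k + 1` fills at most half of each box.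

Conversely, if two tuples of cells differ by a common translation, their letters agree, or both
words are constant, or the first is special (`letters_trichotomy`). Deleting the special words
leaves a set of positive measure in the power `k + 1` (`eventually_goodSet_pos`); on such sets an
orbit keeps the differences between the coordinates, which contradicts ergodicity. Deleting the
constant words too, in the power `k + 2`, leaves a wandering set.

For the zero type, a far away `g` first appears as a difference of cells at a step which it
determines, and there it fixes the letter up to `2 * k` special ones; the overlap is a proportion of
at most `(2 * k + 1) / M m`. The sets `F n` may be enlarged freely, which gives infinite measure
and, for `ℤ ^ d`, cubes. -/

/-! ### The `(C, F)`-space and its action -/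

/-- A `(C, F)`-sequence in `G`: finite sets `F n` and finite families `e n` (enumerating the sets
`C n`) such that the translates `F n + e n j` are disjoint subsets of `F (n + 1)` and such that
`g + F n + C n ⊆ F (n + 1)` eventually, for each `g`. -/
structure CFSeq (G : Type*) [AddCommGroup G] where
  M : ℕ → ℕ
  e : ∀ n, Fin (M n) → G
  F : ℕ → Finset G
  pos : ∀ n, 0 < M n
  zero_mem : ∀ n, 0 ∈ F n
  add_mem : ∀ n, ∀ f ∈ F n, ∀ j, f + e n j ∈ F (n + 1)
  absorb : ∀ g, ∀ᶠ n in atTop, ∀ f ∈ F n, ∀ j, g + f + e n j ∈ F (n + 1)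
  inj : ∀ n, ∀ p ∈ F n, ∀ q ∈ F n, ∀ i j, p + e n i = q + e n j → i = j

namespace CFSeq

variable {G : Type*} [AddCommGroup G] (C : CFSeq G)

/-- The local conditions on a point of the `(C, F)`-space, at the levels from `N` on. -/
def IsPointFrom (N : ℕ) (x : ℕ → Option G) : Prop :=
  ∀ n ≥ N, (∀ f, x n = some f → f ∈ C.F n ∧ ∃ j, x (n + 1) = some (f + C.e n j)) ∧
    (∀ f ∈ C.F n, ∀ j, x (n + 1) = some (f + C.e n j) → x n = some f)

/-- The `(C, F)`-space: `x n = some f` means that `x` lies in the level `f` of the `n`-th tower,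
`x n = none` that it lies outside of the `n`-th tower. -/
def Space : Type _ := {x : ℕ → Option G // C.IsPointFrom 0 x ∧ ∃ n f, x n = some f}

/-- Sequences which from time `n` on move by steps in `C l`. -/
def IsPath (n : ℕ) (ω : ℕ → G) : Prop := ∀ l ≥ n, ∃ j, ω (l + 1) = ω l + C.e l j

/-- The level `f` of the `n`-th tower, extended to all `f` in `G` by translation. -/
def level (n : ℕ) (f : G) : Set C.Space :=
  {x | ∃ ω, C.IsPath n ω ∧ ω n = f ∧ ∀ᶠ l in atTop, x.1 l = some (ω l)}

variable {C}

theorem IsPath.mono {n m : ℕ} {ω : ℕ → G} (h : C.IsPath n ω) (hnm : n ≤ m) : C.IsPath m ω :=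
  fun l hl => h l (hnm.trans hl)

theorem IsPath.mem {n : ℕ} {ω : ℕ → G} (h : C.IsPath n ω) (hn : ω n ∈ C.F n) :
    ∀ l ≥ n, ω l ∈ C.F l := by
  intro l hl
  induction l, hl using Nat.le_induction with
  | base => exact hn
  | succ l hl ih =>
    obtain ⟨j, hj⟩ := h l hl
    rw [hj]
    exact C.add_mem l _ ih j

theorem IsPath.translate {n : ℕ} {ω : ℕ → G} (h : C.IsPath n ω) (g : G) :
    C.IsPath n (fun l => g + ω l) := by
  intro l hl
  obtain ⟨j, hj⟩ := h l hl
  exact ⟨j, by simp only [hj, add_assoc]⟩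

/-- Translated to start at `0`, a path stays in the towers, and `absorb` undoes the translation at
late times. Hence levels `C.level n f` make sense for every `f` in `G`, and every translation is
defined on the whole space. -/
theorem IsPath.eventually_mem {n : ℕ} {ω : ℕ → G} (h : C.IsPath n ω) :
    ∀ᶠ l in atTop, ω l ∈ C.F l := by
  have h' := h.translate (-ω n)
  have hm := h'.mem (by simpa using C.zero_mem n)
  obtain ⟨N, hN⟩ := eventually_atTop.1 (C.absorb (ω n))
  filter_upwards [eventually_ge_atTop (max N n + 1)] with l hl
  obtain ⟨l, rfl⟩ : ∃ l', l = l' + 1 := ⟨l - 1, by omega⟩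
  obtain ⟨j, hj⟩ := h l (by omega)
  have := hN l (by omega) _ (hm l (by omega)) j
  rw [hj]
  simpa using this

/-- The coordinates before `N` are forced: going down, each one is the unique cell compatible with
the next coordinate, or `none` if there is no such cell. -/
theorem exists_pointFrom_zero (N : ℕ) (x : ℕ → Option G) (h : C.IsPointFrom N x) :
    ∃ y, C.IsPointFrom 0 y ∧ ∀ l ≥ N, y l = x l := by
  classical
  induction N generalizing x with
  | zero => exact ⟨x, h, fun _ _ => rfl⟩
  | succ N ih =>
    by_cases hx : ∃ f ∈ C.F N, ∃ j, x (N + 1) = some (f + C.e N j)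
    · obtain ⟨f, hf, j, hj⟩ := hx
      obtain ⟨y, hy, hyx⟩ := ih (Function.update x N (some f)) (by
        intro n hn
        rcases eq_or_lt_of_le hn with rfl | hn
        · have h1 : Function.update x N (some f) (N + 1) = x (N + 1) :=
            Function.update_of_ne (by omega) _ _
          simp only [h1, Function.update_self, hj]
          refine ⟨?_, ?_⟩
          · rintro f' hf'
            cases hf'
            exact ⟨hf, j, rfl⟩
          · intro f' hf' j' hj'
            have h2 : f + C.e N j = f' + C.e N j' := by simpa using hj'
            obtain rfl := C.inj N _ hf _ hf' _ _ h2
            simpa using h2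
        · rw [Function.update_of_ne (by omega), Function.update_of_ne (by omega)]
          exact h n hn)
      refine ⟨y, hy, fun l hl => ?_⟩
      rw [hyx l (by omega), Function.update_of_ne (by omega)]
    · obtain ⟨y, hy, hyx⟩ := ih (Function.update x N none) (by
        intro n hn
        rcases eq_or_lt_of_le hn with rfl | hn
        · have h1 : Function.update x N none (N + 1) = x (N + 1) :=
            Function.update_of_ne (by omega) _ _
          simp only [h1, Function.update_self]
          refine ⟨by simp, ?_⟩
          intro f' hf' j' hj'
          exact (hx ⟨f', hf', j', hj'⟩).elim
        · rw [Function.update_of_ne (by omega), Function.update_of_ne (by omega)]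
          exact h n hn)
      refine ⟨y, hy, fun l hl => ?_⟩
      rw [hyx l (by omega), Function.update_of_ne (by omega)]

theorem exists_point_of_eventually {ω : ℕ → G}
    (h : ∀ᶠ l in atTop, ω l ∈ C.F l ∧ ∃ j, ω (l + 1) = ω l + C.e l j) :
    ∃ x : C.Space, ∀ᶠ l in atTop, x.1 l = some (ω l) := by
  obtain ⟨N, hN⟩ := eventually_atTop.1 h
  obtain ⟨y, hy, hyx⟩ := exists_pointFrom_zero (C := C) N (fun l => some (ω l)) (by
    intro n hn
    obtain ⟨h1, j, hj⟩ := hN n hn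
    refine ⟨?_, ?_⟩
    · rintro f hf
      cases hf
      exact ⟨h1, j, congrArg some hj⟩
    · intro f hf j' hj'
      have h2 : ω n + C.e n j = f + C.e n j' := by rw [← hj]; simpa using hj'
      obtain rfl := C.inj n _ h1 _ hf _ _ h2
      simpa using h2)
  exact ⟨⟨y, hy, N, ω N, hyx N le_rfl⟩, eventually_atTop.2 ⟨N, hyx⟩⟩

theorem IsPath.exists_point {n : ℕ} {ω : ℕ → G} (h : C.IsPath n ω) :
    ∃ x : C.Space, ∀ᶠ l in atTop, x.1 l = some (ω l) := by
  apply exists_point_of_eventually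
  filter_upwards [h.eventually_mem, eventually_ge_atTop n] with l h1 h2
  exact ⟨h1, h l h2⟩

/-- The second clause of `IsPointFrom` makes `none` mean that the point really is outside of the
tower, so that later coordinates determine the earlier ones. -/
theorem eq_of_succ_eq {x y : C.Space} {l : ℕ} (h : x.1 (l + 1) = y.1 (l + 1)) :
    x.1 l = y.1 l := by
  have key : ∀ x y : C.Space, x.1 (l + 1) = y.1 (l + 1) → ∀ f, x.1 l = some f →
      y.1 l = some f := by
    intro x y h f hf
    obtain ⟨h1, j, hj⟩ := (x.2.1 l (Nat.zero_le _)).1 f hf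
    exact (y.2.1 l (Nat.zero_le _)).2 f h1 j (by rw [← h, hj])
  ext f
  exact ⟨key x y h f, key y x h.symm f⟩

theorem eq_of_le_of_eq {x y : C.Space} {l m : ℕ} (hlm : l ≤ m) (h : x.1 m = y.1 m) :
    x.1 l = y.1 l := by
  induction m, hlm using Nat.le_induction with
  | base => exact h
  | succ m _ ih => exact ih (eq_of_succ_eq h)

theorem ext_eventually {x y : C.Space} (h : ∀ᶠ l in atTop, x.1 l = y.1 l) : x = y := by
  obtain ⟨N, hN⟩ := eventually_atTop.1 h
  apply Subtype.ext
  funext l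
  exact eq_of_le_of_eq (le_max_left l N) (hN _ (le_max_right l N))

theorem exists_path (x : C.Space) {n : ℕ} {f : G} (h : x.1 n = some f) :
    ∃ ω, C.IsPath n ω ∧ ω n = f ∧ ∀ l ≥ n, x.1 l = some (ω l) := by
  have key : ∀ l ≥ n, ∃ f, x.1 l = some f := by
    intro l hl
    induction l, hl using Nat.le_induction with
    | base => exact ⟨f, h⟩
    | succ l hl ih =>
      obtain ⟨f', hf'⟩ := ih
      obtain ⟨_, j, hj⟩ := (x.2.1 l (Nat.zero_le _)).1 f' hf'
      exact ⟨_, hj⟩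
  have key2 : ∀ l ≥ n, x.1 l = some ((x.1 l).getD 0) := by
    intro l hl
    obtain ⟨f', hf'⟩ := key l hl
    simp [hf']
  refine ⟨fun l => (x.1 l).getD 0, ?_, by simp [h], key2⟩
  intro l hl
  obtain ⟨_, j, hj⟩ := (x.2.1 l (Nat.zero_le _)).1 _ (key2 l hl)
  exact ⟨j, by simp [hj]⟩

theorem exists_mem_level (x : C.Space) : ∃ n, ∃ f ∈ C.F n, x ∈ C.level n f := by
  obtain ⟨n, f, hf⟩ := x.2.2
  obtain ⟨ω, h1, h2, h3⟩ := exists_path x hf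
  exact ⟨n, f, ((x.2.1 n (Nat.zero_le _)).1 f hf).1, ω, h1, h2, eventually_atTop.2 ⟨n, h3⟩⟩

theorem IsPath.eq_some {x : C.Space} {n : ℕ} {ω : ℕ → G} (h : C.IsPath n ω) (hn : ω n ∈ C.F n)
    (hx : ∀ᶠ l in atTop, x.1 l = some (ω l)) : ∀ l ≥ n, x.1 l = some (ω l) := by
  obtain ⟨N, hN⟩ := eventually_atTop.1 hx
  have hm := h.mem hn
  have key : ∀ d l, n ≤ l → N ≤ l + d → x.1 l = some (ω l) := by
    intro d
    induction d with
    | zero => exact fun l _ hl => hN l hl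
    | succ d ih =>
      intro l hl hl2
      have h1 := ih (l + 1) (by omega) (by omega)
      obtain ⟨j, hj⟩ := h l hl
      exact (x.2.1 l (Nat.zero_le _)).2 _ (hm l hl) j (by rw [h1, hj])
  exact fun l hl => key N l hl (by omega)

theorem mem_level_iff {x : C.Space} {n : ℕ} {f : G} (hf : f ∈ C.F n) :
    x ∈ C.level n f ↔ x.1 n = some f := by
  constructor
  · rintro ⟨ω, h1, rfl, h3⟩
    exact h1.eq_some hf h3 n le_rfl
  · intro h
    obtain ⟨ω, h1, h2, h3⟩ := exists_path x h
    exact ⟨ω, h1, h2, eventually_atTop.2 ⟨n, h3⟩⟩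

theorem exists_translate (g : G) (x : C.Space) :
    ∃ y : C.Space, ∀ᶠ l in atTop, y.1 l = (x.1 l).map (g + ·) := by
  obtain ⟨n, f, hf⟩ := x.2.2
  obtain ⟨ω, h1, h2, h3⟩ := exists_path x hf
  obtain ⟨y, hy⟩ := (h1.translate g).exists_point
  refine ⟨y, ?_⟩
  filter_upwards [hy, eventually_ge_atTop n] with l h4 h5
  rw [h4, h3 l h5]
  rfl

variable (C) in
/-- The `(C, F)`-action of `G`. -/
noncomputable def action : AddAction G C.Space where
  vadd g x := (exists_translate g x).choose
  zero_vadd x := by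
    apply ext_eventually
    filter_upwards [(exists_translate 0 x).choose_spec] with l hl
    refine hl.trans ?_
    simp
  add_vadd g h x := by
    apply ext_eventually
    filter_upwards [(exists_translate (g + h) x).choose_spec, (exists_translate h x).choose_spec,
      (exists_translate g (exists_translate h x).choose).choose_spec] with l h1 h2 h3
    refine h1.trans (Eq.trans ?_ h3.symm)
    rw [h2]
    cases x.1 l <;> simp [add_assoc]

theorem act_eventually (g : G) (x : C.Space) :
    ∀ᶠ l in atTop, (IMP.act C.action g x).1 l = (x.1 l).map (g + ·) :=
  (exists_translate g x).choose_spec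

theorem act_mem_level {g : G} {x : C.Space} {n : ℕ} {f : G} (h : x ∈ C.level n f) :
    IMP.act C.action g x ∈ C.level n (g + f) := by
  obtain ⟨ω, h1, rfl, h3⟩ := h
  refine ⟨_, h1.translate g, rfl, ?_⟩
  filter_upwards [h3, act_eventually g x] with l h4 h5
  rw [h5, h4]
  rfl

theorem act_mem_level_iff {g : G} {x : C.Space} {n : ℕ} {f : G} :
    IMP.act C.action g x ∈ C.level n f ↔ x ∈ C.level n (f - g) := by
  constructor
  · intro h
    have := act_mem_level (g := -g) h
    rwa [← IMP.act_add, neg_add_cancel, IMP.act_zero, neg_add_eq_sub] at this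
  · intro h
    have := act_mem_level (g := g) h
    rwa [add_sub_cancel] at this

theorem level_eq_iUnion (n : ℕ) (f : G) :
    C.level n f = ⋃ j, C.level (n + 1) (f + C.e n j) := by
  classical
  ext x
  simp only [mem_iUnion]
  constructor
  · rintro ⟨ω, h1, rfl, h3⟩
    obtain ⟨j, hj⟩ := h1 n le_rfl
    exact ⟨j, ω, h1.mono (Nat.le_succ n), hj, h3⟩
  · rintro ⟨j, ω, h1, h2, h3⟩
    refine ⟨Function.update ω n f, ?_, by simp, ?_⟩
    · intro l hl
      rcases eq_or_lt_of_le hl with rfl | hl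
      · exact ⟨j, by simp [h2]⟩
      · rw [Function.update_of_ne (by omega), Function.update_of_ne (by omega)]
        exact h1 l hl
    · filter_upwards [h3, eventually_gt_atTop n] with l h4 h5
      rw [Function.update_of_ne (by omega), h4]

theorem disjoint_level {n : ℕ} {p q : G} (hp : p ∈ C.F n) (hq : q ∈ C.F n) (hpq : p ≠ q) :
    Disjoint (C.level n p) (C.level n q) := by
  rw [Set.disjoint_left]
  intro x h1 h2
  rw [mem_level_iff hp] at h1
  rw [mem_level_iff hq, h1] at h2
  exact hpq (by simpa using h2)

theorem level_nonempty (n : ℕ) (f : G) : (C.level n f).Nonempty := by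
  have hpath : C.IsPath n (fun l => f + ∑ i ∈ Finset.Ico n l, C.e i ⟨0, C.pos i⟩) := by
    intro l hl
    refine ⟨⟨0, C.pos l⟩, ?_⟩
    simp only [Finset.sum_Ico_succ_top hl, add_assoc]
  obtain ⟨x, hx⟩ := hpath.exists_point
  exact ⟨x, _, hpath, by simp, hx⟩

/-! ### The Borel structure -/

section Measurable

/-- The discrete `σ`-algebra on the symbols. -/
local instance : MeasurableSpace (Option G) := ⊤

instance : MeasurableSpace C.Space := inferInstanceAs (MeasurableSpace (Subtype _))

theorem measurable_coord (l : ℕ) : Measurable fun x : C.Space => x.1 l :=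
  (measurable_pi_apply l).comp measurable_subtype_coe

theorem measurableSet_coord (l : ℕ) (s : Set (Option G)) :
    MeasurableSet {x : C.Space | x.1 l ∈ s} :=
  measurable_coord l (show @MeasurableSet (Option G) ⊤ s from trivial)

instance [Countable G] : StandardBorelSpace C.Space := by
  have : DiscreteMeasurableSpace (Option G) := ⟨fun _ => trivial⟩
  refine MeasurableSet.standardBorel (s := {x | C.IsPointFrom 0 x ∧ ∃ n f, x n = some f}) ?_
  apply MeasurableSet.inter
  · have : {x | C.IsPointFrom 0 x} = ⋂ n, (fun x : ℕ → Option G => (x n, x (n + 1))) ⁻¹'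
        {q | (∀ f, q.1 = some f → f ∈ C.F n ∧ ∃ j, q.2 = some (f + C.e n j)) ∧
          (∀ f ∈ C.F n, ∀ j, q.2 = some (f + C.e n j) → q.1 = some f)} := by
      ext x
      simp [IsPointFrom]
    change MeasurableSet {x | C.IsPointFrom 0 x}
    rw [this]
    refine MeasurableSet.iInter fun n => ?_
    exact ((measurable_pi_apply n).prodMk (measurable_pi_apply (n + 1)))
      (MeasurableSet.of_discrete)
  · have : {x : ℕ → Option G | ∃ n f, x n = some f} =
        ⋃ n, (fun x : ℕ → Option G => x n) ⁻¹' {q | ∃ f, q = some f} := by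
      ext x
      simp
    change MeasurableSet {x : ℕ → Option G | ∃ n f, x n = some f}
    rw [this]
    exact MeasurableSet.iUnion fun n => measurable_pi_apply n MeasurableSet.of_discrete

theorem measurableSet_level_of_mem {n : ℕ} {f : G} (hf : f ∈ C.F n) :
    MeasurableSet (C.level n f) := by
  have : C.level n f = {x : C.Space | x.1 n ∈ ({some f} : Set (Option G))} := by
    ext x
    simp [mem_level_iff hf]
  rw [this]
  exact measurableSet_coord n _

/-- A property of levels that holds for the levels of the towers and passes from the
sublevels of a level to this level holds for all translated levels. -/
theorem level_induction {P : ℕ → G → Prop} (h1 : ∀ n, ∀ f ∈ C.F n, P n f)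
    (h2 : ∀ n f, (∀ j, P (n + 1) (f + C.e n j)) → P n f) (n : ℕ) (f : G) : P n f := by
  -- After time `N` the translate by `f` of each cell has its sublevels inside the next tower; the
  -- property is then carried back one step at a time.
  obtain ⟨N, hN⟩ := eventually_atTop.1 (C.absorb f)
  have key : ∀ d m, N ≤ m + d → ∀ p ∈ C.F m, P m (f + p) := by
    intro d
    induction d with
    | zero =>
      intro m hm p hp
      exact h2 _ _ fun j => h1 _ _ (hN m hm p hp j)
    | succ d ih =>
      intro m hm p hp
      refine h2 _ _ fun j => ?_
      rw [add_assoc]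
      exact ih (m + 1) (by omega) _ (C.add_mem m p hp j)
  simpa using key N n (by omega) 0 (C.zero_mem n)

theorem measurableSet_level (n : ℕ) (f : G) : MeasurableSet (C.level n f) := by
  refine level_induction (P := fun n f => MeasurableSet (C.level n f))
    (fun n f hf => measurableSet_level_of_mem hf) (fun n f h => ?_) n f
  rw [level_eq_iUnion]
  exact MeasurableSet.iUnion h

variable (C) in
/-- The levels of the towers. -/
def levels : Set (Set C.Space) := {s | ∃ n, ∃ f ∈ C.F n, s = C.level n f}

theorem generateFrom_levels [Countable G] :
    (inferInstance : MeasurableSpace C.Space) = MeasurableSpace.generateFrom C.levels := by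
  have : DiscreteMeasurableSpace (Option G) := ⟨fun _ => trivial⟩
  apply le_antisymm
  · have hc : ∀ l, @Measurable C.Space (Option G) (MeasurableSpace.generateFrom C.levels) ⊤
        (fun x => x.1 l) := by
      intro l
      let _ := MeasurableSpace.generateFrom C.levels
      have hsome : ∀ f, MeasurableSet {x : C.Space | x.1 l = some f} := by
        intro f
        by_cases hf : f ∈ C.F l
        · apply MeasurableSpace.measurableSet_generateFrom
          refine ⟨l, f, hf, ?_⟩
          ext x
          exact (mem_level_iff hf).symm
        · convert MeasurableSet.empty
          ext x
          simp only [mem_ofPred_eq, mem_empty_iff_false, iff_false]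
          exact fun h => hf ((x.2.1 l (Nat.zero_le _)).1 f h).1
      have hnone : {x : C.Space | x.1 l = none} = (⋃ f, {x : C.Space | x.1 l = some f})ᶜ := by
        ext x
        simp only [mem_ofPred_eq, mem_compl_iff, mem_iUnion, not_exists]
        exact Option.eq_none_iff_forall_ne_some
      apply measurable_to_countable'
      rintro (_ | f)
      · change MeasurableSet {x : C.Space | x.1 l = none}
        rw [hnone]
        exact (MeasurableSet.iUnion hsome).compl
      · exact hsome f
    exact measurable_iff_comap_le.1 (@measurable_pi_lambda C.Space ℕ (fun _ => Option G)
      (MeasurableSpace.generateFrom C.levels) _ (fun x => x.1) hc)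
  · apply MeasurableSpace.generateFrom_le
    rintro s ⟨n, f, hf, rfl⟩
    exact measurableSet_level_of_mem hf

theorem measurable_act [Countable G] (g : G) : Measurable (IMP.act C.action g) := by
  have : ∀ s ∈ C.levels, MeasurableSet (IMP.act C.action g ⁻¹' s) := by
    rintro s ⟨n, f, hf, rfl⟩
    convert measurableSet_level (C := C) n (f - g) using 1
    ext x
    exact act_mem_level_iff
  have h2 := @measurable_generateFrom C.Space C.Space _ C.levels (IMP.act C.action g) this
  rwa [← generateFrom_levels] at h2

/-- Levels are nested or disjoint, since a later coordinate determines the earlier ones. -/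
theorem isPiSystem_levels : IsPiSystem C.levels := by
  have key : ∀ n m, n ≤ m → ∀ f ∈ C.F n, ∀ p ∈ C.F m, (C.level n f ∩ C.level m p).Nonempty →
      C.level n f ∩ C.level m p = C.level m p := by
    rintro n m hnm f hf p hp ⟨x, hx1, hx2⟩
    apply inter_eq_right.2
    intro y hy
    rw [mem_level_iff hf] at hx1 ⊢
    rw [mem_level_iff hp] at hx2 hy
    rw [← hx1]
    exact eq_of_le_of_eq hnm (hy.trans hx2.symm)
  rintro _ ⟨n, f, hf, rfl⟩ _ ⟨m, p, hp, rfl⟩ hne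
  rcases le_total n m with h | h
  · exact ⟨m, p, hp, key n m h f hf p hp hne⟩
  · rw [inter_comm] at hne ⊢
    exact ⟨n, f, hf, key m n h p hp f hf hne⟩

end Measurable

end CFSeq

/-! ### The invariant measure -/

namespace CFSeq

variable {G : Type*} [AddCommGroup G] (C : CFSeq G)

instance (n : ℕ) : Nonempty (Fin (C.M n)) := ⟨⟨0, C.pos n⟩⟩

/-- The measure of the levels of the `n`-th tower. -/
noncomputable def width (n : ℕ) : ENNReal := ∏ l ∈ Finset.range n, (C.M l : ENNReal)⁻¹

/-- The Bernoulli measure on the sequences of letters. -/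
noncomputable def bernoulli : Measure (∀ n, Fin (C.M n)) :=
  Measure.infinitePi fun n => ProbabilityTheory.uniformOn (univ : Set (Fin (C.M n)))

theorem isPath_word (n : ℕ) (f : G) (y : ∀ n, Fin (C.M n)) :
    C.IsPath n (fun l => f + ∑ i ∈ Finset.Ico n l, C.e i (y i)) := by
  intro l hl
  refine ⟨y l, ?_⟩
  simp only [Finset.sum_Ico_succ_top hl, add_assoc]

/-- The point of the level `f` of the `n`-th tower with the letters `y l`, `n ≤ l`. -/
noncomputable def point (n : ℕ) (f : G) (y : ∀ n, Fin (C.M n)) : C.Space :=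
  (C.isPath_word n f y).exists_point.choose

variable {C}

theorem point_mem_level (n : ℕ) (f : G) (y : ∀ n, Fin (C.M n)) :
    C.point n f y ∈ C.level n f :=
  ⟨_, C.isPath_word n f y, by simp, (C.isPath_word n f y).exists_point.choose_spec⟩

theorem point_apply {n : ℕ} {f : G} (hf : f ∈ C.F n) (y : ∀ n, Fin (C.M n)) {l : ℕ}
    (hl : n ≤ l) : (C.point n f y).1 l = some (f + ∑ i ∈ Finset.Ico n l, C.e i (y i)) :=
  (C.isPath_word n f y).eq_some (by simpa using hf)
    (C.isPath_word n f y).exists_point.choose_spec l hl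

theorem point_apply_of_le {n : ℕ} {f : G} (hf : f ∈ C.F n) (y y' : ∀ n, Fin (C.M n)) {l : ℕ}
    (hl : l ≤ n) : (C.point n f y).1 l = (C.point n f y').1 l := by
  apply eq_of_le_of_eq hl
  rw [point_apply hf y le_rfl, point_apply hf y' le_rfl]
  simp

theorem measurable_point [Countable G] {n : ℕ} {f : G} (hf : f ∈ C.F n) :
    Measurable (C.point n f) := by
  have : ∀ s ∈ C.levels, MeasurableSet (C.point n f ⁻¹' s) := by
    rintro _ ⟨m, p, hp, rfl⟩
    rcases le_total n m with h | h
    · have : C.point n f ⁻¹' C.level m p = (Finset.restrict (Finset.Ico n m)) ⁻¹'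
          {z : ∀ i : Finset.Ico n m, Fin (C.M i) |
            f + ∑ i : Finset.Ico n m, C.e i (z i) = p} := by
        ext y
        rw [mem_preimage, mem_level_iff hp, point_apply hf y h]
        simp only [mem_preimage, mem_ofPred_eq, Finset.restrict, Option.some.injEq]
        rw [Finset.sum_coe_sort (Finset.Ico n m) (fun i => C.e i (y i))]
      rw [this]
      exact (Finset.measurable_restrict _) MeasurableSet.of_discrete
    · have y0 : ∀ n, Fin (C.M n) := fun n => ⟨0, C.pos n⟩
      have : C.point n f ⁻¹' C.level m p = {y | (C.point n f y0).1 m = some p} := by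
        ext y
        rw [mem_preimage, mem_level_iff hp, point_apply_of_le hf y y0 h]
        rfl
      rw [this]
      exact MeasurableSet.const _
  have h2 := @measurable_generateFrom _ C.Space _ C.levels (C.point n f) this
  rwa [← generateFrom_levels] at h2

variable (C) in
/-- The levels outside of the previous towers. -/
def Start : Type _ :=
  {s : ℕ × G // s.2 ∈ C.F s.1 ∧ ∀ x ∈ C.level s.1 s.2, ∀ l < s.1, x.1 l = none}

variable (C) in
/-- The invariant measure of the `(C, F)`-action. -/
noncomputable def measure [Countable G] : Measure C.Space :=
  Measure.sum fun s : C.Start => C.width s.1.1 • C.bernoulli.map (C.point s.1.1 s.1.2)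

theorem width_mul_bernoulli {m n : ℕ} (hmn : m ≤ n) (y0 : ∀ n, Fin (C.M n)) :
    C.width m * C.bernoulli ((Finset.Ico m n : Set ℕ).pi fun i => {y0 i}) = C.width n := by
  rw [bernoulli, Measure.infinitePi_pi _ fun _ _ => measurableSet_singleton _]
  have : ∀ i, ProbabilityTheory.uniformOn (univ : Set (Fin (C.M i))) {y0 i} =
      (C.M i : ENNReal)⁻¹ := by
    intro i
    rw [ProbabilityTheory.uniformOn_univ]
    simp
  simp only [this]
  rw [width, width, Finset.prod_range_mul_prod_Ico _ hmn]

/-- All points of the level entered the towers through the same cell `s0`. Inside it the level is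
the cylinder fixing the letters from `N` to `n - 1`, of Bernoulli measure `∏ (M l)⁻¹`; the other
summands of the measure do not meet it. -/
theorem measure_level_of_mem [Countable G] {n : ℕ} {f : G} (hf : f ∈ C.F n) :
    C.measure (C.level n f) = C.width n := by
  classical
  obtain ⟨x, hx⟩ := level_nonempty (C := C) n f
  have hxn := (mem_level_iff hf).1 hx
  have hex : ∃ l, ∃ p, x.1 l = some p := ⟨n, f, hxn⟩
  obtain ⟨p, hp⟩ := Nat.find_spec hex
  have hmin : ∀ l < Nat.find hex, x.1 l = none := by
    intro l hl
    rw [Option.eq_none_iff_forall_ne_some]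
    exact fun q hq => Nat.find_min hex hl ⟨q, hq⟩
  have hNn : Nat.find hex ≤ n := Nat.find_min' hex ⟨f, hxn⟩
  generalize Nat.find hex = N at hp hmin hNn
  have hpF : p ∈ C.F N := ((x.2.1 N (Nat.zero_le _)).1 p hp).1
  let s0 : C.Start := ⟨(N, p), hpF, fun x' hx' l hl => by
    rw [← hmin l hl]
    exact eq_of_le_of_eq hl.le (((mem_level_iff hpF).1 hx').trans hp.symm)⟩
  rw [measure, Measure.sum_apply _ (measurableSet_level n f), tsum_eq_single s0]
  · obtain ⟨ω, hω, hωN, hωx⟩ := exists_path x hp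
    have hωF := hω.mem (by rw [hωN]; exact hpF)
    have hy : ∀ l, ∃ j, N ≤ l → ω (l + 1) = ω l + C.e l j := by
      intro l
      by_cases hl : N ≤ l
      · obtain ⟨j, hj⟩ := hω l hl
        exact ⟨j, fun _ => hj⟩
      · exact ⟨⟨0, C.pos l⟩, fun h => (hl h).elim⟩
    choose y0 hy0 using hy
    have hsum : ∀ l ≥ N, ω l = p + ∑ i ∈ Finset.Ico N l, C.e i (y0 i) := by
      intro l hl
      induction l, hl using Nat.le_induction with
      | base => simp [hωN]
      | succ l hl ih => rw [hy0 l hl, ih, Finset.sum_Ico_succ_top hl, add_assoc]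
    rw [Measure.smul_apply, Measure.map_apply (measurable_point hpF) (measurableSet_level n f),
      smul_eq_mul, ← width_mul_bernoulli hNn y0]
    congr 2
    ext y
    rw [mem_preimage, mem_level_iff hf]
    constructor
    · intro hyf i hi
      rw [Finset.coe_Ico, mem_Ico] at hi
      have h1 : ∀ l, N ≤ l → l ≤ n → p + ∑ i ∈ Finset.Ico N l, C.e i (y i) = ω l := by
        intro l hl hl2
        have := eq_of_le_of_eq hl2 (hyf.trans hxn.symm)
        rw [point_apply hpF y hl, hωx l hl] at this
        simpa using this
      have h2 := h1 (i + 1) (by omega) (by omega)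
      rw [Finset.sum_Ico_succ_top hi.1, ← add_assoc, h1 i hi.1 hi.2.le, hy0 i hi.1] at h2
      exact C.inj i _ (hωF i hi.1) _ (hωF i hi.1) _ _ h2
    · intro h
      rw [point_apply hpF y hNn]
      rw [hωx n hNn, hsum n hNn] at hxn
      rw [← hxn]
      congr 2
      refine Finset.sum_congr rfl fun i hi => ?_
      rw [h i (by simpa using hi)]
  · rintro ⟨⟨m, q⟩, hq, hq2⟩ hne
    rw [Measure.smul_apply, Measure.map_apply (measurable_point hq) (measurableSet_level n f)]
    have : C.point m q ⁻¹' C.level n f = ∅ := by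
      rw [Set.eq_empty_iff_forall_notMem]
      intro y hy
      rw [mem_preimage, mem_level_iff hf] at hy
      have h1 := point_apply hq y le_rfl
      have h2 := hq2 _ (point_mem_level m q y)
      have hmn : m ≤ n := by
        by_contra! hlt
        rw [h2 n hlt] at hy
        exact Option.some_ne_none _ hy.symm
      have h3 : ∀ l ≤ n, (C.point m q y).1 l = x.1 l := fun l hl =>
        eq_of_le_of_eq hl (hy.trans hxn.symm)
      rw [h3 m hmn] at h1
      obtain rfl : m = N := by
        rcases lt_trichotomy m N with h | h | h
        · rw [hmin m h] at h1
          exact (Option.some_ne_none _ h1.symm).elim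
        · exact h
        · have h4 := h2 N h
          rw [h3 N hNn, hp] at h4
          exact (Option.some_ne_none _ h4).elim
      rw [hp] at h1
      obtain rfl : p = q := by simpa using h1
      exact hne rfl
    rw [this]
    simp

theorem disjoint_level_succ (n : ℕ) (f : G) {i j : Fin (C.M n)} (hij : i ≠ j) :
    Disjoint (C.level (n + 1) (f + C.e n i)) (C.level (n + 1) (f + C.e n j)) := by
  rw [Set.disjoint_left]
  intro x h1 h2
  have h3 := act_mem_level (g := -f) h1
  have h4 := act_mem_level (g := -f) h2
  rw [neg_add_cancel_left] at h3 h4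
  have hmem : ∀ j, C.e n j ∈ C.F (n + 1) := fun j => by
    simpa using C.add_mem n 0 (C.zero_mem n) j
  refine Set.disjoint_left.1 (disjoint_level (hmem i) (hmem j) fun h => hij ?_) h3 h4
  exact C.inj n 0 (C.zero_mem n) 0 (C.zero_mem n) i j (by rw [h])

theorem width_succ (n : ℕ) : (C.M n : ENNReal) * C.width (n + 1) = C.width n := by
  rw [width, Finset.prod_range_succ, ← width, mul_comm, mul_assoc, ENNReal.inv_mul_cancel, mul_one]
  · exact_mod_cast (C.pos n).ne'
  · simp

theorem measure_level [Countable G] (n : ℕ) (f : G) : C.measure (C.level n f) = C.width n := by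
  refine level_induction (P := fun n f => C.measure (C.level n f) = C.width n)
    (fun n f hf => measure_level_of_mem hf) (fun n f h => ?_) n f
  rw [level_eq_iUnion, measure_iUnion (fun i j hij => disjoint_level_succ n f hij)
    fun j => measurableSet_level _ _]
  simp [h, width_succ]

theorem width_ne_top (n : ℕ) : C.width n ≠ ⊤ := by
  rw [width]
  refine ENNReal.prod_ne_top fun l _ => ?_
  simpa using (C.pos l).ne'

theorem width_ne_zero (n : ℕ) : C.width n ≠ 0 := by
  rw [width, Finset.prod_ne_zero_iff]
  simp

theorem countable_levels : C.levels.Countable := by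
  have : C.levels = ⋃ n, ⋃ f ∈ C.F n, {C.level n f} := by
    ext s
    simp [levels]
  rw [this]
  exact countable_iUnion fun n => (C.F n).countable_toSet.biUnion fun f _ => countable_singleton _

theorem sUnion_levels : ⋃₀ C.levels = univ := by
  rw [Set.eq_univ_iff_forall]
  intro x
  obtain ⟨n, f, hf, hx⟩ := exists_mem_level x
  exact ⟨_, ⟨n, f, hf, rfl⟩, hx⟩

instance [Countable G] : SigmaFinite C.measure := by
  refine Measure.sigmaFinite_of_countable countable_levels ?_ sUnion_levels
  rintro _ ⟨n, f, hf, rfl⟩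
  rw [measure_level]
  exact (width_ne_top n).lt_top

/-- Translation permutes the levels, also those outside of the towers, and `measure_level` depends
only on `n`; the levels are a generating `π`-system. -/
theorem isMeasurePreserving_action [Countable G] :
    IMP.IsMeasurePreserving C.action C.measure := by
  intro g
  refine ⟨measurable_act g, ?_⟩
  symm
  have hpre : ∀ n f, IMP.act C.action g ⁻¹' C.level n f = C.level n (f - g) := fun n f => by
    ext x
    exact act_mem_level_iff
  have hlev : ∀ s ∈ C.levels, C.measure s = C.measure.map (IMP.act C.action g) s := by
    rintro _ ⟨n, f, hf, rfl⟩
    rw [Measure.map_apply (measurable_act g) (measurableSet_level _ _), hpre, measure_level,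
      measure_level]
  refine Measure.ext_of_generateFrom_of_cover generateFrom_levels countable_levels
    isPiSystem_levels sUnion_levels ?_ ?_ hlev
  · rintro _ ⟨n, f, hf, rfl⟩
    rw [measure_level]
    exact width_ne_top n
  · intro t ht s hs
    rcases (s ∩ t).eq_empty_or_nonempty with h | h
    · simp [h]
    · exact hlev _ (isPiSystem_levels _ hs _ ht h)

end CFSeq

/-! ### Approximation by refining families -/

/-- A refining sequence of finite families of disjoint sets of finite measure which exhaust the
space and generate its `σ`-algebra. -/
structure IsRefiningSeq {Y A : Type*} [MeasurableSpace Y] (ν : Measure Y) (S : ℕ → Finset A)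
    (Q : ℕ → A → Set Y) : Prop where
  measurableSet : ∀ n, ∀ a ∈ S n, MeasurableSet (Q n a)
  measure_ne_top : ∀ n, ∀ a ∈ S n, ν (Q n a) ≠ ⊤
  disjoint : ∀ n, ∀ a ∈ S n, ∀ b ∈ S n, a ≠ b → Disjoint (Q n a) (Q n b)
  exists_refinement : ∀ n, ∀ a ∈ S n, ∃ R ⊆ S (n + 1), Q n a = ⋃ b ∈ R, Q (n + 1) b
  cover : ∀ y, ∃ n, ∃ a ∈ S n, y ∈ Q n a
  generate : (inferInstance : MeasurableSpace Y) =
    MeasurableSpace.generateFrom {s | ∃ n, ∃ a ∈ S n, s = Q n a}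

namespace IsRefiningSeq

variable {Y A : Type*} [MeasurableSpace Y] {ν : Measure Y} {S : ℕ → Finset A} {Q : ℕ → A → Set Y}

theorem exists_refine (h : IsRefiningSeq ν S Q) {n m : ℕ} (hnm : n ≤ m) {R : Finset A}
    (hR : R ⊆ S n) : ∃ R' ⊆ S m, ⋃ a ∈ R, Q n a = ⋃ a ∈ R', Q m a := by
  classical
  induction m, hnm using Nat.le_induction with
  | base => exact ⟨R, hR, rfl⟩
  | succ m _ ih =>
    obtain ⟨R', hR', h'⟩ := ih
    choose! T hT hT' using h.exists_refinement m
    refine ⟨R'.biUnion T, Finset.biUnion_subset.2 fun a ha => hT a (hR' ha), ?_⟩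
    rw [h', Finset.set_biUnion_biUnion]
    exact iUnion₂_congr fun a ha => hT' a (hR' ha)

theorem iUnion_sdiff (h : IsRefiningSeq ν S Q) [DecidableEq A] {n : ℕ} {R R' : Finset A}
    (hR : R ⊆ S n) (hR' : R' ⊆ S n) :
    (⋃ a ∈ R, Q n a) \ ⋃ a ∈ R', Q n a = ⋃ a ∈ R \ R', Q n a := by
  ext y
  simp only [Set.mem_sdiff, mem_iUnion, Finset.mem_sdiff, exists_prop, not_exists, not_and]
  constructor
  · rintro ⟨⟨a, ha, hy⟩, h2⟩
    exact ⟨a, ⟨ha, fun ha' => h2 a ha' hy⟩, hy⟩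
  · rintro ⟨a, ⟨ha, ha'⟩, hy⟩
    refine ⟨⟨a, ha, hy⟩, fun b hb hyb => ?_⟩
    have hab : a ≠ b := fun hab => ha' (hab ▸ hb)
    exact Set.disjoint_left.1 (h.disjoint n a (hR ha) b (hR' hb) hab) hy hyb

theorem isSetRing (h : IsRefiningSeq ν S Q) :
    IsSetRing {s | ∃ n, ∃ R ⊆ S n, s = ⋃ a ∈ R, Q n a} := by
  classical
  have key : ∀ s t, s ∈ {s | ∃ n, ∃ R ⊆ S n, s = ⋃ a ∈ R, Q n a} →
      t ∈ {s | ∃ n, ∃ R ⊆ S n, s = ⋃ a ∈ R, Q n a} → ∃ n, ∃ R ⊆ S n, ∃ R' ⊆ S n,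
        s = (⋃ a ∈ R, Q n a) ∧ t = ⋃ a ∈ R', Q n a := by
    rintro _ _ ⟨n, R, hR, rfl⟩ ⟨m, R', hR', rfl⟩
    obtain ⟨R1, h1, h1'⟩ := h.exists_refine (le_max_left n m) hR
    obtain ⟨R2, h2, h2'⟩ := h.exists_refine (le_max_right n m) hR'
    exact ⟨_, R1, h1, R2, h2, h1', h2'⟩
  refine ⟨⟨0, ∅, by simp, by simp⟩, fun s t hs ht => ?_, fun s t hs ht => ?_⟩
  · obtain ⟨n, R, hR, R', hR', rfl, rfl⟩ := key s t hs ht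
    exact ⟨n, R ∪ R', Finset.union_subset hR hR', by rw [Finset.set_biUnion_union]⟩
  · obtain ⟨n, R, hR, R', hR', rfl, rfl⟩ := key s t hs ht
    exact ⟨n, R \ R', Finset.sdiff_subset.trans hR, h.iUnion_sdiff hR hR'⟩

theorem measurableSet_iUnion (h : IsRefiningSeq ν S Q) {n : ℕ} {R : Finset A} (hR : R ⊆ S n) :
    MeasurableSet (⋃ a ∈ R, Q n a) :=
  R.measurableSet_biUnion fun a ha => h.measurableSet n a (hR ha)

theorem tower_subset (h : IsRefiningSeq ν S Q) {n m : ℕ} (hnm : n ≤ m) :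
    ⋃ a ∈ S n, Q n a ⊆ ⋃ a ∈ S m, Q m a := by
  obtain ⟨R, hR, hR'⟩ := h.exists_refine hnm (Finset.Subset.refl (S n))
  rw [hR']
  exact biUnion_subset_biUnion_left hR

theorem iUnion_tower (h : IsRefiningSeq ν S Q) : ⋃ n, ⋃ a ∈ S n, Q n a = univ := by
  rw [Set.eq_univ_iff_forall]
  intro y
  obtain ⟨n, a, ha, hy⟩ := h.cover y
  simp only [mem_iUnion]
  exact ⟨n, a, ha, hy⟩

theorem tendsto_measure_sdiff (h : IsRefiningSeq ν S Q) {B : Set Y} (hB : MeasurableSet B)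
    (hB' : ν B ≠ ⊤) : Tendsto (fun n => ν (B \ ⋃ a ∈ S n, Q n a)) atTop (𝓝 0) := by
  have := tendsto_measure_iInter_atTop (μ := ν) (s := fun n => B \ ⋃ a ∈ S n, Q n a)
    (fun n => (hB.diff (h.measurableSet_iUnion (Finset.Subset.refl _))).nullMeasurableSet)
    (fun n m hnm => sdiff_subset_sdiff_right (h.tower_subset hnm))
    ⟨0, ne_top_of_le_ne_top hB' (measure_mono sdiff_subset)⟩
  have h0 : ⋂ n, B \ ⋃ a ∈ S n, Q n a = ∅ := by
    rw [← Set.sdiff_iUnion, h.iUnion_tower, sdiff_univ]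
  rwa [h0, measure_empty] at this

theorem eventually_exists_symmDiff_lt (h : IsRefiningSeq ν S Q) {B : Set Y}
    (hB : MeasurableSet B) (hB' : ν B ≠ ⊤) {ε : ENNReal} (hε : 0 < ε) :
    ∀ᶠ n in atTop, ∃ R ⊆ S n, ν (symmDiff B (⋃ a ∈ R, Q n a)) < ε := by
  classical
  have hε2 : 0 < ε / 2 := ENNReal.half_pos hε.ne'
  obtain ⟨N, hN⟩ := ((h.tendsto_measure_sdiff hB hB').eventually_lt_const hε2).exists
  -- The approximation by a ring of sets is used for a finite measure, so `B` is cut down to one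
  -- tower `V` that misses less than `ε / 2` of it.
  set V := ⋃ a ∈ S N, Q N a with hV
  have hVm : MeasurableSet V := h.measurableSet_iUnion (Finset.Subset.refl _)
  have : IsFiniteMeasure (ν.restrict V) := by
    refine ⟨?_⟩
    rw [Measure.restrict_apply_univ, hV]
    exact (measure_biUnion_finset_le _ _).trans_lt
      (ENNReal.sum_lt_top.2 fun a ha => (h.measure_ne_top N a ha).lt_top)
  have hcover : ∃ D : Set (Set Y), D.Countable ∧ D ⊆ {s | ∃ n, ∃ R ⊆ S n, s = ⋃ a ∈ R, Q n a} ∧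
      ν.restrict V (⋃₀ D)ᶜ = 0 := by
    refine ⟨{s | ∃ n, s = ⋃ a ∈ S n, Q n a}, ?_, ?_, ?_⟩
    · have : {s | ∃ n, s = ⋃ a ∈ S n, Q n a} = range fun n => ⋃ a ∈ S n, Q n a := by
        ext s
        simp [eq_comm]
      rw [this]
      exact countable_range _
    · rintro _ ⟨n, rfl⟩
      exact ⟨n, S n, Finset.Subset.refl _, rfl⟩
    · have : ⋃₀ {s | ∃ n, s = ⋃ a ∈ S n, Q n a} = univ := by
        rw [Set.eq_univ_iff_forall]
        intro y
        obtain ⟨n, a, ha, hy⟩ := h.cover y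
        exact ⟨_, ⟨n, rfl⟩, mem_biUnion ha hy⟩
      rw [this]
      simp
  have hgen : (inferInstance : MeasurableSpace Y) =
      MeasurableSpace.generateFrom {s | ∃ n, ∃ R ⊆ S n, s = ⋃ a ∈ R, Q n a} := by
    apply le_antisymm
    · refine h.generate.le.trans (MeasurableSpace.generateFrom_mono ?_)
      rintro _ ⟨n, a, ha, rfl⟩
      exact ⟨n, {a}, by simpa using ha, by simp⟩
    · apply MeasurableSpace.generateFrom_le
      rintro _ ⟨n, R, hR, rfl⟩
      exact h.measurableSet_iUnion hR
  obtain ⟨t, ht, htB⟩ := exists_measure_symmDiff_lt_of_generateFrom_isSetRing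
    (μ := ν.restrict V) h.isSetRing hcover hgen hB hε2
  have htm : MeasurableSet t := by
    obtain ⟨n, R, hR, rfl⟩ := ht
    exact h.measurableSet_iUnion hR
  rw [Measure.restrict_apply (htm.symmDiff hB)] at htB
  obtain ⟨n, R, hR, hR'⟩ := h.isSetRing.inter_mem ht ⟨N, S N, Finset.Subset.refl _, hV⟩
  filter_upwards [eventually_ge_atTop n] with m hm
  obtain ⟨R2, h2, h2'⟩ := h.exists_refine hm hR
  refine ⟨R2, h2, ?_⟩
  rw [← h2', ← hR']
  have hsub : symmDiff B (t ∩ V) ⊆ (symmDiff t B ∩ V) ∪ (B \ V) := by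
    intro y
    simp only [Set.mem_symmDiff, mem_inter_iff, mem_union, Set.mem_sdiff]
    tauto
  calc ν (symmDiff B (t ∩ V)) ≤ ν (symmDiff t B ∩ V) + ν (B \ V) :=
        (measure_mono hsub).trans (measure_union_le _ _)
    _ < ε / 2 + ε / 2 := ENNReal.add_lt_add htB hN
    _ = ε := ENNReal.add_halves ε

/-- A form of the density theorem: if every piece had a proportion of at least `ε` outside of `B`,
then so would any union of pieces, contradicting the approximation of a subset of `B` of finite
positive measure. -/
theorem eventually_exists_measure_sdiff_lt [SigmaFinite ν] (h : IsRefiningSeq ν S Q) {B : Set Y}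
    (hB : MeasurableSet B) (hB' : ν B ≠ 0) {ε : ENNReal} (hε : 0 < ε) (hε1 : ε ≤ 1) :
    ∀ᶠ n in atTop, ∃ a ∈ S n, ν (Q n a \ B) < ε * ν (Q n a) := by
  obtain ⟨B', hB'm, hBB', hpos, hfin⟩ :
      ∃ B', MeasurableSet B' ∧ B' ⊆ B ∧ 0 < ν B' ∧ ν B' < ⊤ := by
    obtain ⟨t, h1, h2, h3, h4⟩ := Measure.exists_subset_measure_lt_top hB (pos_iff_ne_zero.2 hB')
    exact ⟨t, h1, h2, h3, h4⟩
  have hε0 : ε ≠ ⊤ := ne_top_of_le_ne_top ENNReal.one_ne_top hε1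
  have hp : 0 < ε * ν B' := ENNReal.mul_pos hε.ne' hpos.ne'
  have hpt : ε * ν B' ≠ ⊤ := ENNReal.mul_ne_top hε0 hfin.ne
  have hδ : 0 < ε * ν B' / 4 := ENNReal.div_pos hp.ne' (by simp)
  filter_upwards [h.eventually_exists_symmDiff_lt hB'm hfin.ne hδ] with n ⟨R, hR, hlt⟩
  by_contra! hcon
  set U := ⋃ a ∈ R, Q n a with hU
  have hUm : MeasurableSet U := h.measurableSet_iUnion hR
  have hd : ∀ a ∈ R, ∀ b ∈ R, a ≠ b → Disjoint (Q n a) (Q n b) := fun a ha b hb hab =>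
    h.disjoint n a (hR ha) b (hR hb) hab
  have h1 : ε * ν U ≤ ν (U \ B) := by
    have e1 : U \ B = ⋃ a ∈ R, Q n a \ B := by
      rw [hU]
      ext y
      simp only [Set.mem_sdiff, mem_iUnion, exists_prop]
      tauto
    rw [e1, hU, measure_biUnion_finset (fun a ha b hb hab => hd a ha b hb hab)
      (fun a ha => h.measurableSet n a (hR ha)), measure_biUnion_finset
      (fun a ha b hb hab => (hd a ha b hb hab).mono sdiff_subset sdiff_subset)
      (fun a ha => (h.measurableSet n a (hR ha)).diff hB), Finset.mul_sum]
    exact Finset.sum_le_sum fun a ha => hcon a (hR ha)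
  have h2 : ν (U \ B) ≤ ν (symmDiff B' U) :=
    measure_mono fun y hy => Or.inr ⟨hy.1, fun hy' => hy.2 (hBB' hy')⟩
  have h3 : ν B' ≤ ν U + ν (symmDiff B' U) := by
    refine (measure_mono ?_).trans (measure_union_le U (symmDiff B' U))
    intro y hy
    by_cases hyU : y ∈ U
    · exact Or.inl hyU
    · exact Or.inr (Or.inl ⟨hy, hyU⟩)
  have h4 : ε * ν B' < ε * ν B' := by
    calc ε * ν B' ≤ ε * ν U + ε * ν (symmDiff B' U) := by rw [← mul_add]; gcongr
      _ ≤ ν (symmDiff B' U) + 1 * ν (symmDiff B' U) := by gcongr; exact h1.trans h2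
      _ < ε * ν B' / 4 + ε * ν B' / 4 := by rw [one_mul]; exact ENNReal.add_lt_add hlt hlt
      _ ≤ ε * ν B' / 2 + ε * ν B' / 2 := by
        gcongr <;> norm_num
      _ = ε * ν B' := ENNReal.add_halves _
  exact lt_irrefl _ h4

end IsRefiningSeq

/-! ### Boxes in Cartesian powers -/

namespace CFSeq

variable {G : Type*} [AddCommGroup G] (C : CFSeq G) {ι : Type*}

/-- The product of levels, a box in the product space. -/
def box (n : ℕ) (f : ι → G) : Set (ι → C.Space) := Set.pi univ fun i => C.level n (f i)

/-- The displacement of a tuple of letters. -/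
def shift (n : ℕ) (j : ι → Fin (C.M n)) : ι → G := fun i => C.e n (j i)

variable {C}

theorem mem_box {n : ℕ} {f : ι → G} {x : ι → C.Space} :
    x ∈ C.box n f ↔ ∀ i, x i ∈ C.level n (f i) := by
  simp [box]

theorem box_eq_iUnion (n : ℕ) (f : ι → G) :
    C.box n f = ⋃ j : ι → Fin (C.M n), C.box (n + 1) (f + C.shift n j) := by
  ext x
  simp only [mem_iUnion, mem_box]
  constructor
  · intro h
    have : ∀ i, ∃ j, x i ∈ C.level (n + 1) (f i + C.e n j) := fun i => by
      have := h i
      rw [level_eq_iUnion] at this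
      simpa using this
    choose j hj using this
    exact ⟨j, hj⟩
  · rintro ⟨j, hj⟩ i
    rw [level_eq_iUnion]
    exact mem_iUnion.2 ⟨j i, hj i⟩

theorem disjoint_box_succ (n : ℕ) (f : ι → G) {j j' : ι → Fin (C.M n)} (h : j ≠ j') :
    Disjoint (C.box (n + 1) (f + C.shift n j)) (C.box (n + 1) (f + C.shift n j')) := by
  obtain ⟨i, hi⟩ := Function.ne_iff.1 h
  rw [Set.disjoint_left]
  intro x h1 h2
  exact Set.disjoint_left.1 (disjoint_level_succ n (f i) hi) (mem_box.1 h1 i) (mem_box.1 h2 i)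

theorem disjoint_box {n : ℕ} {p q : ι → G} (hp : ∀ i, p i ∈ C.F n) (hq : ∀ i, q i ∈ C.F n)
    (h : p ≠ q) : Disjoint (C.box n p) (C.box n q) := by
  obtain ⟨i, hi⟩ := Function.ne_iff.1 h
  rw [Set.disjoint_left]
  intro x h1 h2
  exact Set.disjoint_left.1 (disjoint_level (hp i) (hq i) hi) (mem_box.1 h1 i) (mem_box.1 h2 i)

theorem level_subset_tower {n m : ℕ} (hnm : n ≤ m) {f : G} (hf : f ∈ C.F n) {x : C.Space}
    (hx : x ∈ C.level n f) : ∃ p ∈ C.F m, x ∈ C.level m p := by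
  induction m, hnm using Nat.le_induction with
  | base => exact ⟨f, hf, hx⟩
  | succ m _ ih =>
    obtain ⟨p, hp, hxp⟩ := ih
    rw [level_eq_iUnion] at hxp
    obtain ⟨j, hj⟩ := mem_iUnion.1 hxp
    exact ⟨_, C.add_mem m p hp j, hj⟩

variable [Fintype ι]

theorem measurableSet_box (n : ℕ) (f : ι → G) : MeasurableSet (C.box n f) :=
  MeasurableSet.univ_pi fun i => measurableSet_level n (f i)

theorem measure_box [Countable G] (n : ℕ) (f : ι → G) :
    (Measure.pi fun _ : ι => C.measure) (C.box n f) = C.width n ^ Fintype.card ι := by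
  rw [box, Measure.pi_pi]
  simp [measure_level]

theorem measure_box_ne_top [Countable G] (n : ℕ) (f : ι → G) :
    (Measure.pi fun _ : ι => C.measure) (C.box n f) ≠ ⊤ := by
  rw [measure_box]
  exact ENNReal.pow_ne_top (width_ne_top n)

theorem isRefiningSeq_level [Countable G] : IsRefiningSeq C.measure C.F C.level where
  measurableSet n a _ := measurableSet_level n a
  measure_ne_top n a _ := by rw [measure_level]; exact width_ne_top n
  disjoint _ _ ha _ hb hab := disjoint_level ha hb hab
  exists_refinement n a ha := by
    classical
    refine ⟨Finset.univ.image fun j => a + C.e n j, ?_, ?_⟩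
    · intro b hb
      obtain ⟨j, -, rfl⟩ := Finset.mem_image.1 hb
      exact C.add_mem n a ha j
    · rw [level_eq_iUnion]
      simp
  cover := exists_mem_level
  generate := generateFrom_levels

theorem isRefiningSeq_box [Countable G] [DecidableEq ι] :
    IsRefiningSeq (Measure.pi fun _ : ι => C.measure)
      (fun n => Fintype.piFinset fun _ : ι => C.F n) C.box where
  measurableSet n a _ := measurableSet_box n a
  measure_ne_top n a _ := measure_box_ne_top n a
  disjoint _ _ ha _ hb hab := disjoint_box (by simpa using ha) (by simpa using hb) hab
  exists_refinement n a ha := by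
    classical
    refine ⟨Finset.univ.image fun j => a + C.shift n j, ?_, ?_⟩
    · intro b hb
      obtain ⟨j, -, rfl⟩ := Finset.mem_image.1 hb
      exact Fintype.mem_piFinset.2 fun i => C.add_mem n _ (Fintype.mem_piFinset.1 ha i) _
    · rw [box_eq_iUnion]
      simp
  cover x := by
    choose n f hf hx using fun i => exists_mem_level (x i)
    choose p hp hxp using fun i => level_subset_tower
      (Finset.le_sup (f := n) (Finset.mem_univ i)) (hf i) (hx i)
    exact ⟨_, p, by simpa using hp, mem_box.2 hxp⟩
  generate := by
    apply le_antisymm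
    · refine iSup_le fun i => ?_
      have hgen : (instMeasurableSpaceSpace : MeasurableSpace C.Space) = _ := generateFrom_levels
      beta_reduce
      rw [hgen, MeasurableSpace.comap_generateFrom]
      apply MeasurableSpace.generateFrom_le
      rintro _ ⟨_, ⟨n, f, hf, rfl⟩, rfl⟩
      -- The remaining coordinates are unrestricted, but each point has all its coordinates in a
      -- common late tower; so the cylinder is a countable union of boxes.
      have key : (fun x : ι → C.Space => x i) ⁻¹' C.level n f =
          ⋃ m : ℕ, ⋃ p ∈ {p : ι → G | p ∈ Fintype.piFinset (fun _ : ι => C.F m) ∧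
            C.level m (p i) ⊆ C.level n f}, C.box m p := by
        ext x
        simp only [mem_preimage, mem_iUnion, mem_ofPred_eq, Fintype.mem_piFinset, exists_prop]
        constructor
        · intro hx
          choose N g hg hxg using fun i => exists_mem_level (x i)
          have hn : n ≤ max n (Finset.univ.sup N) := le_max_left _ _
          choose p hp hxp using fun i => level_subset_tower
            ((Finset.le_sup (f := N) (Finset.mem_univ i)).trans
              (le_max_right n (Finset.univ.sup N))) (hg i) (hxg i)
          refine ⟨_, p, ⟨hp, ?_⟩, mem_box.2 hxp⟩
          intro y hy
          rw [mem_level_iff hf] at hx ⊢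
          have h1 := (mem_level_iff (hp i)).1 (hxp i)
          rw [mem_level_iff (hp i)] at hy
          rw [← hx]
          exact eq_of_le_of_eq hn (hy.trans h1.symm)
        · rintro ⟨m, p, ⟨hp, hsub⟩, hx⟩
          exact hsub (mem_box.1 hx i)
      rw [key]
      refine @MeasurableSet.iUnion _ _ (_) _ _ fun m => ?_
      refine @MeasurableSet.biUnion _ _ (_) _ _ ?_ fun p hp => ?_
      · exact (Fintype.piFinset (fun _ : ι => C.F m)).finite_toSet.countable.mono fun p hp => hp.1
      · exact MeasurableSpace.measurableSet_generateFrom ⟨m, p, hp.1, rfl⟩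
    · apply MeasurableSpace.generateFrom_le
      rintro _ ⟨n, a, _, rfl⟩
      exact measurableSet_box n a

end CFSeq

/-! ### A Sidon sequence with planted coincidences -/

section Sidon

theorem four_pow_add_eq {a b c d : ℕ} (h : 4 ^ a + 4 ^ b = 4 ^ c + 4 ^ d) :
    (a = c ∧ b = d) ∨ (a = d ∧ b = c) := by
  have key : ∀ a b c d : ℕ, 4 ^ a + 4 ^ b = 4 ^ c + 4 ^ d → b ≤ a → d ≤ c → a ≤ c := by
    intro a b c d h hba hdc
    by_contra! hlt
    have h1 : 4 ^ (c + 1) ≤ 4 ^ a := Nat.pow_le_pow_right (by norm_num) hlt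
    have h2 : 4 ^ d ≤ 4 ^ c := Nat.pow_le_pow_right (by norm_num) hdc
    have h3 : 0 < 4 ^ c := by positivity
    have h4 : 0 < 4 ^ b := by positivity
    rw [pow_succ] at h1
    omega
  have key2 : ∀ a b c d : ℕ, 4 ^ a + 4 ^ b = 4 ^ c + 4 ^ d → b ≤ a → d ≤ c → a = c ∧ b = d := by
    intro a b c d h hba hdc
    obtain rfl := le_antisymm (key a b c d h hba hdc) (key c d a b h.symm hdc hba)
    exact ⟨rfl, Nat.pow_right_injective (le_refl 2 |>.trans (by norm_num : 2 ≤ 4))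
      (by simpa using h)⟩
  rcases le_total b a with h1 | h1 <;> rcases le_total d c with h2 | h2
  · exact Or.inl (key2 a b c d h h1 h2)
  · exact Or.inr (key2 a b d c (by omega) h1 h2)
  · exact Or.inr (key2 b a c d (by omega) h1 h2).symm
  · exact Or.inl (key2 b a d c (by omega) h1 h2).symm

/-- A sequence which is a Sidon set up to the coincidences forced by
`sidon k (k + i) = sidon k i + 1` for `i < k`. -/
def sidon (k j : ℕ) : ℕ := if k ≤ j ∧ j < 2 * k then 4 ^ (j - k + 1) + 1 else 4 ^ (j + 1)

/-- Each term is a multiple of `4` plus `0` or `1`. Reduction mod `4` separates the units, and a sum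
of two powers of `4` determines the exponents; only the pairs `i`, `k + i` share an exponent. -/
theorem sidon_add_eq {k i j i' j' : ℕ}
    (h : sidon k j + sidon k i' = sidon k i + sidon k j') :
    (i = j ∧ i' = j') ∨ (i = i' ∧ j = j') ∨ (i < 2 * k ∧ i' < 2 * k ∧ i ≠ j ∧ i' ≠ j') := by
  have key : ∀ j, ∃ E s, sidon k j = 4 * 4 ^ E + s ∧
      ((k ≤ j ∧ j < 2 * k ∧ E + k = j ∧ s = 1) ∨ (¬ (k ≤ j ∧ j < 2 * k) ∧ E = j ∧ s = 0)) := by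
    intro j
    by_cases hj : k ≤ j ∧ j < 2 * k
    · exact ⟨j - k, 1, by rw [sidon, if_pos hj, pow_succ'], Or.inl (by omega)⟩
    · exact ⟨j, 0, by rw [sidon, if_neg hj, pow_succ', add_zero], Or.inr (by omega)⟩
  obtain ⟨E1, s1, e1, h1⟩ := key j
  obtain ⟨E2, s2, e2, h2⟩ := key i'
  obtain ⟨E3, s3, e3, h3⟩ := key i
  obtain ⟨E4, s4, e4, h4⟩ := key j'
  rw [e1, e2, e3, e4] at h
  have hs : s1 + s2 = s3 + s4 := by omega
  have hE := four_pow_add_eq (show 4 ^ E1 + 4 ^ E2 = 4 ^ E3 + 4 ^ E4 by omega)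
  omega

end Sidon

/-! ### Choice of the parameters -/

section Admissible

variable {G : Type*} [AddCommGroup G]

/-- The differences of the family `e` separate the differences of elements of `F`, with exceptions
among the first `2 * k` indices. -/
def IsSparse (k : ℕ) (F : Finset G) {M : ℕ} (e : Fin M → G) : Prop :=
  ∀ p ∈ F, ∀ q ∈ F, ∀ p' ∈ F, ∀ q' ∈ F, ∀ i j i' j',
    q - p + (e j - e i) = q' - p' + (e j' - e i') →
    (i = j ∧ i' = j') ∨ (i = i' ∧ j = j') ∨
      ((i : ℕ) < 2 * k ∧ (i' : ℕ) < 2 * k ∧ i ≠ j ∧ i' ≠ j')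

/-- A large multiple of the Sidon sequence along `g₀` dominates all the differences from the finite
set `F`, and subtracting the offsets `u i` from the letters `k + i` is a bounded perturbation. The
planted relation, with `g = R • g₀`, comes from `sidon k (k + i) = sidon k i + 1`. -/
theorem exists_isSparse {g₀ : G} (h₀ : addOrderOf g₀ = 0) (F : Finset G) (k M : ℕ)
    (hM : 2 * k ≤ M) (u : Fin k → G) :
    ∃ (e : Fin M → G) (g : G), IsSparse k F e ∧
      ∀ i : Fin k, e ⟨k + i, by omega⟩ = e ⟨i, by omega⟩ + g - u i := by
  classical
  have hinj : Function.Injective fun z : ℤ => z • g₀ := by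
    rw [injective_zsmul_iff_not_isOfFinAddOrder]
    exact addOrderOf_eq_zero_iff.1 h₀
  let W : Fin M → G := fun j =>
    if h : k ≤ (j : ℕ) ∧ (j : ℕ) < 2 * k then u ⟨j - k, by omega⟩ else 0
  let T : Finset G := (F ×ˢ F ×ˢ F ×ˢ F ×ˢ (Finset.univ : Finset (Fin M × Fin M × Fin M × Fin M))).image
    fun t => t.2.2.2.1 - t.2.2.1 - (t.2.1 - t.1) +
      (W t.2.2.2.2.2.1 - W t.2.2.2.2.1 - (W t.2.2.2.2.2.2.2 - W t.2.2.2.2.2.2.1))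
  -- `T` collects all the possible errors. Only finitely many multiples of `g₀` are errors, so a
  -- multiple of `R` among them must be `0`.
  have hfin : ((fun z : ℤ => z • g₀) ⁻¹' T).Finite := T.finite_toSet.preimage hinj.injOn
  obtain ⟨R, hR⟩ : ∃ R : ℤ, ∀ z : ℤ, z • g₀ ∈ T → |z| < R := by
    obtain ⟨R, hR⟩ := (hfin.image fun z => |z|).bddAbove
    exact ⟨R + 1, fun z hz => Int.lt_add_one_iff.2 (hR ⟨z, hz, rfl⟩)⟩
  refine ⟨fun j => (R * sidon k j) • g₀ - W j, R • g₀, ?_, ?_⟩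
  · intro p hp q hq p' hp' q' hq' i j i' j' h
    have hz : (R * ((sidon k j : ℤ) + sidon k i' - (sidon k i + sidon k j'))) • g₀ ∈ T := by
      refine Finset.mem_image.2 ⟨(p, q, p', q', i, j, i', j'), by simp [*], ?_⟩
      simp only [mul_sub, mul_add, sub_smul, add_smul]
      beta_reduce at h
      rw [← sub_eq_zero] at h ⊢
      rw [← neg_eq_zero, ← h]
      abel
    have hz2 : (sidon k j : ℤ) + sidon k i' - (sidon k i + sidon k j') = 0 := by
      have h1 := hR _ hz
      by_contra h2
      have h3 := Int.one_le_abs h2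
      rw [abs_mul] at h1
      have h4 : 0 ≤ |R| := abs_nonneg R
      have h5 := le_abs_self R
      nlinarith
    have h6 := sidon_add_eq (k := k) (i := i) (j := j) (i' := i') (j' := j') (by omega)
    simpa [Fin.ext_iff] using h6
  · intro i
    have h1 : W ⟨k + i, by omega⟩ = u i := by
      have : k ≤ k + (i : ℕ) ∧ k + (i : ℕ) < 2 * k := by omega
      simp only [W, this]
      simp
    have h2 : W ⟨i, by omega⟩ = 0 := by
      have : ¬ (k ≤ (i : ℕ) ∧ (i : ℕ) < 2 * k) := by omega
      simp only [W, this]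
      simp
    have h3 : sidon k (k + i) = sidon k i + 1 := by
      rw [sidon, sidon, if_pos (by omega), if_neg (by omega)]
      simp
    simp only [h1, h2, h3, Nat.cast_add, mul_add, add_smul]
    simp

/-- There are sequences `M` growing like `n ^ (1 / k)` and `u`, constant on dyadic blocks, such that
the series of `M n ^ (-k)` diverges along each of the values of `u`. -/
theorem exists_schedule {V : Type*} [Countable V] [Nonempty V] {k : ℕ} (hk : 0 < k) :
    ∃ (u : ℕ → V) (M : ℕ → ℕ), (∀ n, 2 * k ≤ M n) ∧ Tendsto M atTop atTop ∧
      (Summable fun n => ((M n : ℝ) ^ (k + 1))⁻¹) ∧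
      ∀ v, ¬ Summable fun n => ({n | u n = v}.indicator (fun n => ((M n : ℝ) ^ k)⁻¹) n : ℝ) := by
  obtain ⟨w, hw⟩ := exists_surjective_nat V
  have hk' : (k : ℝ) ≠ 0 := by positivity
  let a : ℕ → ℝ := fun n => ((n : ℝ) + 1) ^ (1 / k : ℝ)
  have ha1 : ∀ n, 1 ≤ a n := fun n => Real.one_le_rpow (by simp) (by positivity)
  have hak : ∀ n, a n ^ k = (n : ℝ) + 1 := fun n => by
    rw [← Real.rpow_natCast, ← Real.rpow_mul (by positivity), one_div_mul_cancel hk',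
      Real.rpow_one]
  have haM : ∀ n, a n ≤ ((⌈a n⌉₊ + 2 * k : ℕ) : ℝ) := fun n => by
    push_cast
    have := Nat.le_ceil (a n)
    have : (0 : ℝ) ≤ k := by positivity
    linarith
  have hMa : ∀ n, ((⌈a n⌉₊ + 2 * k : ℕ) : ℝ) ≤ (2 * k + 2) * a n := fun n => by
    push_cast
    have := (Nat.ceil_lt_add_one (zero_le_one.trans (ha1 n))).le
    have : (0 : ℝ) ≤ k := by positivity
    nlinarith [ha1 n]
  refine ⟨fun n => w (Nat.unpair (Nat.log 2 (n + 1))).1, fun n => ⌈a n⌉₊ + 2 * k,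
    fun n => Nat.le_add_left _ _, ?_, ?_, ?_⟩
  · refine tendsto_natCast_atTop_iff (R := ℝ).1 (tendsto_atTop_mono haM ?_)
    exact (tendsto_rpow_atTop (by positivity)).comp
      (tendsto_atTop_add_const_right _ _ tendsto_natCast_atTop_atTop)
  · have h1 : Summable fun n : ℕ => (((n : ℝ) + 1) ^ ((k + 1 : ℝ) / k))⁻¹ := by
      have := (summable_nat_add_iff 1).2 ((Real.summable_nat_rpow_inv (p := (k + 1 : ℝ) / k)).2 (by
        rw [lt_div_iff₀ (by positivity)]
        linarith))
      simpa using this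
    refine h1.of_nonneg_of_le (fun n => by positivity) fun n => ?_
    have h2 : ((n : ℝ) + 1) ^ ((k + 1 : ℝ) / k) = a n ^ (k + 1) := by
      rw [← Real.rpow_natCast, ← Real.rpow_mul (by positivity)]
      congr 1
      push_cast
      ring
    rw [h2]
    have := ha1 n
    gcongr
    exact haM n
  · intro v hs
    obtain ⟨t, ht⟩ := hw v
    have hc : (0 : ℝ) < ((2 * k + 2 : ℝ) ^ k)⁻¹ / 2 := by positivity
    obtain ⟨s, hs⟩ := summable_iff_vanishing_norm.1 hs _ hc
    obtain ⟨N, hN⟩ := s.bddAbove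
    -- The block number `j` carries the value `w t = v` and lies beyond `N`; its `2 ^ j` terms are
    -- each at least a constant over `2 ^ (j + 1)`, against the Cauchy criterion.
    set j := Nat.pair t (N + 1) with hj
    have hjN : N + 1 < 2 ^ j := (Nat.right_le_pair t (N + 1)).trans_lt Nat.lt_two_pow_self
    have hpow : 2 ^ (j + 1) = 2 * 2 ^ j := pow_succ' 2 j
    have h2 := hs (Finset.Ico (2 ^ j - 1) (2 ^ (j + 1) - 1)) (by
      rw [Finset.disjoint_left]
      intro n hn hns
      have := hN hns
      rw [Finset.mem_Ico] at hn
      omega)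
    have h3 : ∀ n ∈ Finset.Ico (2 ^ j - 1) (2 ^ (j + 1) - 1),
        ((2 * k + 2 : ℝ) ^ k)⁻¹ / 2 ^ (j + 1) ≤
        {n | w (Nat.unpair (Nat.log 2 (n + 1))).1 = v}.indicator
          (fun n => (((⌈a n⌉₊ + 2 * k : ℕ) : ℝ) ^ k)⁻¹) n := by
      intro n hn
      rw [Finset.mem_Ico] at hn
      have h1 : w (Nat.unpair (Nat.log 2 (n + 1))).1 = v := by
        rw [(Nat.log_eq_iff (m := j) (Or.inr ⟨by norm_num, by omega⟩)).2 (by omega), hj,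
          Nat.unpair_pair]
        exact ht
      rw [Set.indicator_of_mem (by exact h1), div_eq_mul_inv, ← mul_inv]
      have h0 : 1 ≤ a n := ha1 n
      have h4 : (((⌈a n⌉₊ + 2 * k : ℕ) : ℝ)) ^ k ≤ (2 * k + 2 : ℝ) ^ k * 2 ^ (j + 1) := by
        calc (((⌈a n⌉₊ + 2 * k : ℕ) : ℝ)) ^ k ≤ ((2 * k + 2) * a n) ^ k := by
              gcongr
              exact hMa n
          _ = (2 * k + 2 : ℝ) ^ k * (n + 1) := by rw [mul_pow, hak]
          _ ≤ (2 * k + 2 : ℝ) ^ k * 2 ^ (j + 1) := by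
              gcongr
              have : n + 1 ≤ 2 ^ (j + 1) := by omega
              exact_mod_cast this
      have h5 : (0 : ℝ) < (((⌈a n⌉₊ + 2 * k : ℕ) : ℝ)) ^ k :=
        pow_pos (lt_of_lt_of_le (by linarith) (haM n)) k
      exact inv_anti₀ h5 h4
    have h6 := Finset.card_nsmul_le_sum _ _ _ h3
    have hcard : 2 ^ (j + 1) - 1 - (2 ^ j - 1) = 2 ^ j := by omega
    rw [Nat.card_Ico, hcard, nsmul_eq_mul] at h6
    have h7 : ((2 ^ j : ℕ) : ℝ) * (((2 * k + 2 : ℝ) ^ k)⁻¹ / 2 ^ (j + 1)) =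
        ((2 * k + 2 : ℝ) ^ k)⁻¹ / 2 := by
      push_cast
      rw [pow_succ]
      field_simp
    rw [h7] at h6
    exact absurd (h6.trans (le_abs_self _)) (not_le.2 h2)

/-- The properties of the parameters of a `(C, F)`-sequence on which the dynamics depends. -/
structure IsAdmissible (C : CFSeq G) (k : ℕ) (u : ℕ → Fin k → G) : Prop where
  mono : ∀ n, C.F n ⊆ C.F (n + 1)
  card_le : ∀ n, n * ∏ l ∈ Finset.range n, C.M l ≤ (C.F n).card
  sparse : ∀ n, IsSparse k (C.F n) (C.e n)
  two_mul_le : ∀ n, 2 * k ≤ C.M n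
  special : ∀ n, ∃ (g : G) (b b' : Fin k → Fin (C.M n)), ∀ i, b i ≠ b' i ∧
    C.e n (b' i) = C.e n (b i) + g - u n i
  tendsto : Tendsto C.M atTop atTop
  summable : Summable fun n => ((C.M n : ℝ) ^ (k + 1))⁻¹
  not_summable : ∀ v, ¬ Summable fun n =>
    ({n | u n = v}.indicator (fun n => ((C.M n : ℝ) ^ k)⁻¹) n : ℝ)

/-- `M` and `u` are fixed in advance. Given `F n`, sparse letters are chosen for it, and then `F (n
+ 1)` is any set with `P` that contains the finitely many elements required by the axioms. -/
theorem exists_isAdmissible [Countable G] {g₀ : G} (h₀ : addOrderOf g₀ = 0) {k : ℕ} (hk : 0 < k)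
    {P : Finset G → Prop} (hP : ∀ S, ∃ F, P F ∧ S ⊆ F) :
    ∃ (C : CFSeq G) (u : ℕ → Fin k → G), (∀ n, P (C.F n)) ∧ IsAdmissible C k u := by
  classical
  have hinf : Infinite G := by
    have hinj : Function.Injective fun z : ℤ => z • g₀ := by
      rw [injective_zsmul_iff_not_isOfFinAddOrder]
      exact addOrderOf_eq_zero_iff.1 h₀
    exact Infinite.of_injective _ hinj
  obtain ⟨enum, henum⟩ := exists_surjective_nat G
  obtain ⟨u, M, hM, hMt, hMs, hMn⟩ := exists_schedule (V := Fin k → G) hk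
  choose! e g he hg using fun (F : Finset G) (n : ℕ) => exists_isSparse h₀ F k (M n) (hM n) (u n)
  -- Filler sets that make the towers large enough for infinite measure.
  choose E hE using fun n : ℕ => Infinite.exists_subset_card_eq G
    ((n + 1) * ∏ l ∈ Finset.range (n + 1), M l)
  choose next hnext hnext' using hP
  let S : ℕ → Finset G → Finset G := fun n F =>
    F ∪ E n ∪ (F ×ˢ (Finset.univ : Finset (Fin (M n)))).image (fun t => t.1 + e F n t.2) ∪
      (Finset.range (n + 1) ×ˢ F ×ˢ (Finset.univ : Finset (Fin (M n)))).image
        (fun t => enum t.1 + t.2.1 + e F n t.2.2)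
  let F : ℕ → Finset G := fun n => Nat.rec (next {0}) (fun n F => next (S n F)) n
  have hF : ∀ n, F (n + 1) = next (S n (F n)) := fun n => rfl
  have hSF : ∀ n, S n (F n) ⊆ F (n + 1) := fun n => hnext' _
  have hmono : ∀ n, F n ⊆ F (n + 1) := fun n =>
    Finset.Subset.trans (by
      intro x hx
      simp only [S, Finset.mem_union]
      tauto) (hSF n)
  let C : CFSeq G :=
    { M := M
      e := fun n => e (F n) n
      F := F
      pos := fun n => lt_of_lt_of_le (by omega) (hM n)
      zero_mem := fun n => by
        induction n with
        | zero => exact hnext' {0} (by simp)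
        | succ n ih => exact hmono n ih
      add_mem := fun n f hf j => by
        apply hSF n
        refine Finset.mem_union_left _ (Finset.mem_union_right _ ?_)
        exact Finset.mem_image.2 ⟨(f, j), by simpa using hf, rfl⟩
      absorb := fun g => by
        obtain ⟨m, rfl⟩ := henum g
        filter_upwards [eventually_ge_atTop m] with n hn f hf j
        apply hSF n
        refine Finset.mem_union_right _ ?_
        refine Finset.mem_image.2 ⟨(m, f, j), ?_, rfl⟩
        simp only [Finset.mem_product, Finset.mem_range, Finset.mem_univ, and_true]
        exact ⟨by omega, hf⟩
      inj := fun n p hp q hq i j h => by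
        -- Sparseness against the trivial difference: with the second pair of letters equal, the
        -- exceptional case is void.
        have := he (F n) n p hp q hq p hp p hp i j j j (by
          rw [sub_self, sub_self, add_zero]
          rw [← sub_eq_zero] at h
          rw [← neg_eq_zero, ← h]
          abel)
        tauto }
  refine ⟨C, u, ?_, ?_⟩
  · intro n
    cases n with
    | zero => exact hnext _
    | succ n => exact hnext _
  · exact
      { mono := hmono
        card_le := by
          intro n
          cases n with
          | zero => simp
          | succ n =>
            refine (hE n).symm.le.trans (Finset.card_le_card ?_)
            refine Finset.Subset.trans ?_ (hSF n)
            exact Finset.subset_union_right.trans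
              (Finset.subset_union_left.trans Finset.subset_union_left)
        sparse := fun n => he (F n) n
        two_mul_le := hM
        special := fun n => by
          have := hM n
          refine ⟨g (F n) n, fun i => ⟨i, ?_⟩, fun i => ⟨k + i, ?_⟩, fun i => ⟨?_, ?_⟩⟩
          · change (i : ℕ) < M n
            omega
          · change k + (i : ℕ) < M n
            omega
          · simp only [ne_eq, Fin.mk.injEq]
            omega
          · exact hg (F n) n i
        tendsto := hMt
        summable := hMs
        not_summable := hMn }

end Admissible

/-! ### Averaging along a tree -/

section TreeBound

theorem tendsto_prod_one_sub {p : ℕ → ℝ} (h0 : ∀ n, 0 ≤ p n) (h1 : ∀ n, p n ≤ 1)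
    (hp : ¬ Summable p) (n : ℕ) :
    Tendsto (fun t => ∏ i ∈ Finset.range t, (1 - p (n + i))) atTop (𝓝 0) := by
  have hp' : ¬ Summable fun i => p (n + i) := by
    simpa only [add_comm n] using fun h => hp ((summable_nat_add_iff n).1 h)
  have hdiv := (not_summable_iff_tendsto_nat_atTop_of_nonneg fun i => h0 (n + i)).1 hp'
  refine squeeze_zero (fun t => Finset.prod_nonneg fun i _ => sub_nonneg.2 (h1 _)) (fun t => ?_)
    (Real.tendsto_exp_neg_atTop_nhds_zero.comp hdiv)
  rw [Function.comp_apply, ← Finset.sum_neg_distrib, Real.exp_sum]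
  exact Finset.prod_le_prod (fun i _ => sub_nonneg.2 (h1 _))
    fun i _ => Real.one_sub_le_exp_neg _

/-- A subadditive function on a tree that is bounded by `W` is bounded by `W / 2` if it is so on
average over sets `U n` of letters with non-summable frequencies. -/
theorem le_half_of_sum_le {A : Type*} [Add A] {L : ℕ → Type*} [∀ n, Fintype (L n)]
    [∀ n, Nonempty (L n)] {sh : ∀ n, L n → A} (U : ∀ n, Finset (L n)) {W : ℕ → ℝ}
    {φ : ℕ → A → ℝ} (hW : ∀ n, Fintype.card (L n) * W (n + 1) = W n)
    (hφ : ∀ n f, φ n f ≤ ∑ j, φ (n + 1) (f + sh n j)) (hle : ∀ n f, φ n f ≤ W n)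
    (hU : ∀ n f, ∑ j ∈ U n, φ (n + 1) (f + sh n j) ≤ (U n).card * (W (n + 1) / 2))
    (hns : ¬ Summable fun n => ((U n).card : ℝ) / Fintype.card (L n)) (n : ℕ) (f : A) :
    φ n f ≤ W n / 2 := by
  classical
  set p : ℕ → ℝ := fun n => ((U n).card : ℝ) / Fintype.card (L n) with hp
  have hL : ∀ n, (0 : ℝ) < Fintype.card (L n) := fun n => by exact_mod_cast Fintype.card_pos
  have h0 : ∀ n, 0 ≤ p n := fun n => by positivity
  have h1 : ∀ n, p n ≤ 1 := fun n => by
    rw [hp, div_le_one (hL n)]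
    exact_mod_cast Finset.card_le_univ _
  -- The excess over `W n / 2` survives only outside of `U`, so each step multiplies its bound by `1
  -- - p n`; the product tends to `0`.
  have key : ∀ t n f, φ n f ≤ W n / 2 + W n / 2 * ∏ i ∈ Finset.range t, (1 - p (n + i)) := by
    intro t
    induction t with
    | zero =>
      intro n f
      simpa using hle n f
    | succ t ih =>
      intro n f
      set x := ∏ i ∈ Finset.range t, (1 - p (n + 1 + i)) with hx
      have h2 : ∏ i ∈ Finset.range (t + 1), (1 - p (n + i)) = (1 - p n) * x := by
        rw [Finset.prod_range_succ', mul_comm, hx, add_zero]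
        congr 1
        exact Finset.prod_congr rfl fun i _ => by rw [add_assoc, add_comm 1 i]
      have h3 : ∑ j ∈ (U n)ᶜ, φ (n + 1) (f + sh n j) ≤
          (Fintype.card (L n) - (U n).card : ℝ) * (W (n + 1) / 2 + W (n + 1) / 2 * x) := by
        refine (Finset.sum_le_card_nsmul _ _ _ fun j _ => ih (n + 1) (f + sh n j)).trans ?_
        rw [nsmul_eq_mul, Finset.card_compl, Nat.cast_sub (Finset.card_le_univ _)]
      have h4 := hφ n f
      rw [← Finset.sum_add_sum_compl (U n)] at h4
      have h5 : p n * Fintype.card (L n) = (U n).card := div_mul_cancel₀ _ (hL n).ne'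
      rw [h2, ← hW n]
      calc φ n f ≤ (U n).card * (W (n + 1) / 2) +
          (Fintype.card (L n) - (U n).card : ℝ) * (W (n + 1) / 2 + W (n + 1) / 2 * x) :=
            h4.trans (add_le_add (hU n f) h3)
        _ = _ := by rw [← h5]; ring
  have hlim : Tendsto (fun t => W n / 2 + W n / 2 * ∏ i ∈ Finset.range t, (1 - p (n + i))) atTop
      (𝓝 (W n / 2 + W n / 2 * 0)) :=
    ((tendsto_prod_one_sub h0 h1 hns n).const_mul _).const_add _
  rw [mul_zero, add_zero] at hlim
  exact ge_of_tendsto' hlim fun t => key t n f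

end TreeBound

/-! ### Ergodicity of the power `k` and conservativity of the power `k + 1` -/

namespace CFSeq

variable {G : Type*} [AddCommGroup G] {C : CFSeq G} {ι : Type*}

theorem act_image_eq_preimage {X : Type*} (T : AddAction G X) (g : G) (B : Set X) :
    IMP.act T g '' B = IMP.act T (-g) ⁻¹' B := by
  ext x
  constructor
  · rintro ⟨y, hy, rfl⟩
    rwa [mem_preimage, ← IMP.act_add, neg_add_cancel, IMP.act_zero]
  · intro h
    exact ⟨_, h, by rw [← IMP.act_add, add_neg_cancel, IMP.act_zero]⟩

theorem e_injective (n : ℕ) : Function.Injective (C.e n) := fun i j h =>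
  C.inj n 0 (C.zero_mem n) 0 (C.zero_mem n) i j (by rw [h])

variable {S : AddAction G (ι → C.Space)} {δ : G → ι → G}

theorem preimage_box (hS : ∀ g x i, IMP.act S g x i = IMP.act C.action (δ g i) (x i)) (g : G)
    (n : ℕ) (f : ι → G) : IMP.act S g ⁻¹' C.box n f = C.box n (f - δ g) := by
  ext x
  simp only [mem_preimage, mem_box, hS, act_mem_level_iff, Pi.sub_apply]

variable [Fintype ι]

variable (C ι) in
/-- The measure of the boxes of level `n`. -/
noncomputable def boxMeasure (n : ℕ) : ℝ := (C.width n ^ Fintype.card ι).toReal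

theorem boxMeasure_pos (n : ℕ) : 0 < C.boxMeasure ι n :=
  ENNReal.toReal_pos (pow_ne_zero _ (width_ne_zero n)) (ENNReal.pow_ne_top (width_ne_top n))

theorem card_mul_boxMeasure [DecidableEq ι] (n : ℕ) :
    (Fintype.card (ι → Fin (C.M n)) : ℝ) * C.boxMeasure ι (n + 1) = C.boxMeasure ι n := by
  rw [boxMeasure, boxMeasure, ← width_succ n, mul_pow, ENNReal.toReal_mul]
  simp

variable [Countable G]

variable (C ι) in
/-- The product measure. -/
noncomputable abbrev prodMeasure : Measure (ι → C.Space) := Measure.pi fun _ => C.measure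

theorem measure_inter_box [DecidableEq ι] (A : Set (ι → C.Space)) (hA : MeasurableSet A) (n : ℕ) (f : ι → G) :
    (C.prodMeasure ι).real (A ∩ C.box n f) =
      ∑ j, (C.prodMeasure ι).real (A ∩ C.box (n + 1) (f + C.shift n j)) := by
  rw [box_eq_iUnion, inter_iUnion, measureReal_def, measure_iUnion
    (fun i j hij => (disjoint_box_succ n f hij).mono inter_subset_right inter_subset_right)
    (fun j => hA.inter (measurableSet_box _ _)), tsum_fintype, ENNReal.toReal_sum]
  · rfl
  · exact fun j _ => ne_top_of_le_ne_top (measure_box_ne_top _ _) (measure_mono inter_subset_right)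

theorem measureReal_box (n : ℕ) (f : ι → G) :
    (C.prodMeasure ι).real (C.box n f) = C.boxMeasure ι n := by
  rw [measureReal_def, measure_box, boxMeasure]

theorem measureReal_inter_box_le (A : Set (ι → C.Space)) (n : ℕ) (f : ι → G) :
    (C.prodMeasure ι).real (A ∩ C.box n f) ≤ C.boxMeasure ι n := by
  rw [← measureReal_box n f]
  exact measureReal_mono inter_subset_right (measure_box_ne_top n f)

/-- Each set of positive measure fills more than three quarters of some box of level `n`, for all
large `n`. -/
theorem eventually_exists_measureReal_gt {B : Set (ι → C.Space)} (hB : MeasurableSet B)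
    (hB' : C.prodMeasure ι B ≠ 0) :
    ∀ᶠ n in atTop, ∃ f : ι → G, 3 / 4 * C.boxMeasure ι n <
      (C.prodMeasure ι).real (B ∩ C.box n f) := by
  classical
  filter_upwards [isRefiningSeq_box.eventually_exists_measure_sdiff_lt hB hB'
    (ε := ENNReal.ofReal (1 / 4)) (by simp) (by simp)] with n ⟨f, _, hf⟩
  refine ⟨f, ?_⟩
  have h1 := (ENNReal.toReal_lt_toReal (ne_top_of_lt hf)
    (ENNReal.mul_ne_top ENNReal.ofReal_ne_top (measure_box_ne_top n f))).2 hf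
  rw [ENNReal.toReal_mul, ENNReal.toReal_ofReal (by norm_num)] at h1
  change (C.prodMeasure ι).real _ < 1 / 4 * (C.prodMeasure ι).real _ at h1
  have h2 := measureReal_sdiff_add_inter (μ := C.prodMeasure ι) (s := C.box n f) hB
    (h := measure_box_ne_top n f)
  rw [measureReal_box] at h1 h2
  rw [inter_comm]
  linarith

theorem measurePreserving_prod (hS : ∀ g x i, IMP.act S g x i = IMP.act C.action (δ g i) (x i))
    (g : G) : MeasurePreserving (IMP.act S g) (C.prodMeasure ι) (C.prodMeasure ι) := by
  have h := measurePreserving_pi (fun _ : ι => C.measure) (fun _ : ι => C.measure)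
    (fun i => isMeasurePreserving_action (C := C) (δ g i))
  have : IMP.act S g = fun x i => IMP.act C.action (δ g i) (x i) := by
    funext x i
    exact hS g x i
  rwa [this]

theorem measureReal_preimage_inter_box
    (hS : ∀ g x i, IMP.act S g x i = IMP.act C.action (δ g i) (x i)) {A : Set (ι → C.Space)}
    (hA : MeasurableSet A) (g : G) (n : ℕ) (f : ι → G) :
    (C.prodMeasure ι).real (IMP.act S g ⁻¹' A ∩ C.box n (f - δ g)) =
      (C.prodMeasure ι).real (A ∩ C.box n f) := by
  rw [← preimage_box hS, ← preimage_inter, measureReal_def, measureReal_def,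
    (measurePreserving_prod hS g).measure_preimage
      (hA.inter (measurableSet_box n f)).nullMeasurableSet]

/-- The function `a n f - a n (f + v)` compares the masses of an invariant set in two boxes. On the
planted pair of words, used whenever `u n` fits `v`, it is at most half of the box measure on
average. The two words have frequency `2 * M n ^ (-k)`, so the tree bound applies everywhere. -/
theorem isErgodic_of_isAdmissible {k : ℕ} (hk : 0 < k) {u : ℕ → Fin k → G}
    (hC : IsAdmissible C k u) {S : AddAction G (Fin k → C.Space)} {δ : G → Fin k → G}
    (hS : ∀ g x i, IMP.act S g x i = IMP.act C.action (δ g i) (x i))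
    (hδ : ∀ i, (∀ g, δ g i = g) ∨ ∀ g, δ g i = -g) :
    IMP.IsErgodic S (IMP.powMeasure C.measure k) := by
  classical
  refine @ErgodicVAdd.mk G _ S.toVAdd _ _ (@VAddInvariantMeasure.mk _ _ S.toVAdd _ _
    fun g s hs => (measurePreserving_prod hS g).measure_preimage hs.nullMeasurableSet) ?_
  intro A hA hinv
  change ∀ g, IMP.act S g ⁻¹' A =ᵐ[C.prodMeasure (Fin k)] A at hinv
  change EventuallyConst A (ae (C.prodMeasure (Fin k)))
  rw [eventuallyConst_set']
  by_contra! hcon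
  obtain ⟨hA0, hA1⟩ := hcon
  rw [ae_eq_empty] at hA0
  rw [ae_eq_univ] at hA1
  -- More than `3 / 4` of one box lies in `A` and less than `1 / 4` of the other, so the difference
  -- exceeds one half of the box measure.
  obtain ⟨n, ⟨f, hf⟩, f', hf'⟩ := ((eventually_exists_measureReal_gt hA hA0).and
    (eventually_exists_measureReal_gt hA.compl hA1)).exists
  set v := f' - f with hv
  set a : ℕ → (Fin k → G) → ℝ := fun n f => (C.prodMeasure (Fin k)).real (A ∩ C.box n f) with ha
  have ha_inv : ∀ n f g, a n (f - δ g) = a n f := fun n f g => by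
    rw [ha]
    beta_reduce
    rw [← measureReal_preimage_inter_box hS hA g n f]
    exact measureReal_congr ((hinv g).symm.inter (ae_eq_refl _))
  have ha0 : ∀ n f, 0 ≤ a n f := fun n f => measureReal_nonneg
  have ha1 : ∀ n f, a n f ≤ C.boxMeasure (Fin k) n := measureReal_inter_box_le A
  -- In the coordinates where `T⁻¹` acts, the sign of `v` and the roles of `b` and `b'` are
  -- exchanged, so that the same `g` serves all the coordinates.
  let v' : Fin k → G := fun i => if ∀ g, δ g i = g then v i else -v i
  have hpair : ∀ n, ∃ s s' : Fin k → Fin (C.M n), s ≠ s' ∧ (u n = v' →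
      ∃ g, C.shift n s = v + C.shift n s' - δ g) := by
    intro n
    obtain ⟨g, b, b', hb⟩ := hC.special n
    refine ⟨fun i => if ∀ g, δ g i = g then b i else b' i,
      fun i => if ∀ g, δ g i = g then b' i else b i, ?_, fun huv => ⟨g, ?_⟩⟩
    · intro h
      have h1 := congrFun h ⟨0, hk⟩
      beta_reduce at h1
      split_ifs at h1
      · exact (hb _).1 h1
      · exact (hb _).1 h1.symm
    · funext i
      have h1 := congrFun huv i
      have h2 := (hb i).2
      simp only [shift, Pi.sub_apply, Pi.add_apply]
      simp only [v'] at h1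
      split_ifs at h1 ⊢ with h3
      · rw [h3, h2, h1]
        abel
      · rw [((hδ i).resolve_left h3) g, h2, h1]
        abel
  choose s s' hss hs using hpair
  have hbound := le_half_of_sum_le (sh := fun n => C.shift (ι := Fin k) n)
    (fun n => if u n = v' then {s n, s' n} else ∅)
    (W := C.boxMeasure (Fin k)) (φ := fun n f => a n f - a n (f + v)) card_mul_boxMeasure
    (fun n f => by
      rw [Finset.sum_sub_distrib]
      apply le_of_eq
      congr 1
      · exact measure_inter_box A hA n f
      · refine (measure_inter_box A hA n (f + v)).trans ?_
        exact Finset.sum_congr rfl fun j _ => by rw [add_right_comm])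
    (fun n f => by linarith [ha0 n (f + v), ha1 n f])
    (fun n f => by
      split_ifs with huv
      · obtain ⟨g, hg⟩ := hs n huv
        rw [Finset.sum_pair (hss n), Finset.card_pair (hss n)]
        -- These two terms cancel in the sum over the pair of words, which leaves at most one box
        -- measure.
        have h1 : a (n + 1) (f + C.shift n (s n)) = a (n + 1) (f + C.shift n (s' n) + v) := by
          rw [← ha_inv (n + 1) (f + C.shift n (s' n) + v) g, hg]
          congr 1
          abel
        have h2 := ha0 (n + 1) (f + C.shift n (s n) + v)
        have h3 := ha1 (n + 1) (f + C.shift n (s' n))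
        push_cast
        linarith
      · simp)
    (fun hsum => hC.not_summable v' ((hsum.mul_left (1 / 2)).congr fun n => by
      simp only [Set.indicator_apply, mem_ofPred_eq]
      split_ifs with huv
      · rw [Finset.card_pair (hss n)]
        simp
        ring
      · simp)) n f
  have hff' : f + v = f' := by rw [hv]; abel
  have h1 : (C.prodMeasure (Fin k)).real (Aᶜ ∩ C.box n f') + a n f' =
      C.boxMeasure (Fin k) n := by
    rw [← measureReal_box n f', inter_comm, ha, ← sdiff_eq]
    beta_reduce
    rw [inter_comm A]
    exact measureReal_sdiff_add_inter hA (h := measure_box_ne_top n f')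
  rw [hff'] at hbound
  have h2 := boxMeasure_pos (C := C) (ι := Fin k) n
  change 3 / 4 * _ < a n f at hf
  linarith

/-- Boxes with constant words `c` and `c'` are translates of each other under the diagonal action of
`e c' - e c`. A wandering set has disjoint traces there, so it fills at most half of them on
average. Constant words have frequency `M n / M n ^ (k + 1)`, which is not summable. -/
theorem isConservative_of_isAdmissible {k : ℕ} (hk : 0 < k) {u : ℕ → Fin k → G}
    (hC : IsAdmissible C k u) : IMP.IsConservative (IMP.powAction C.action (k + 1))
      (IMP.powMeasure C.measure (k + 1)) := by
  classical
  intro B hB hB0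
  change 0 < C.prodMeasure (Fin (k + 1)) B at hB0
  change ∃ g, g ≠ 0 ∧ 0 < C.prodMeasure (Fin (k + 1)) _
  by_contra! hcon
  have hS : ∀ g x i, IMP.act (IMP.powAction C.action (k + 1)) g x i =
      IMP.act C.action ((fun g _ => g : G → Fin (k + 1) → G) g i) (x i) := fun _ _ _ => rfl
  obtain ⟨n, f, hf⟩ := (eventually_exists_measureReal_gt hB hB0.ne').exists
  set a : ℕ → (Fin (k + 1) → G) → ℝ :=
    fun n f => (C.prodMeasure (Fin (k + 1))).real (B ∩ C.box n f) with ha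
  have hdiag : ∀ n, Function.Injective fun (c : Fin (C.M n)) (_ : Fin (k + 1)) => c :=
    fun n c c' h => congrFun h 0
  have hpair : ∀ n f (c c' : Fin (C.M n)), c ≠ c' →
      a (n + 1) (f + C.shift n fun _ => c) + a (n + 1) (f + C.shift n fun _ => c') ≤
        C.boxMeasure (Fin (k + 1)) (n + 1) := by
    intro n f c c' hcc
    set g := C.e n c' - C.e n c with hg
    have hg0 : g ≠ 0 := sub_ne_zero.2 fun h => hcc (e_injective n h).symm
    have hnull : (C.prodMeasure (Fin (k + 1)))
        (IMP.act (IMP.powAction C.action (k + 1)) g ⁻¹' B ∩ B) = 0 := by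
      have := hcon (-g) (neg_ne_zero.2 hg0)
      rwa [act_image_eq_preimage, neg_neg, nonpos_iff_eq_zero] at this
    have h1 := measureReal_preimage_inter_box hS hB g (n + 1) (f + C.shift n fun _ => c')
    have h2 : (f + C.shift n fun _ => c') - (fun _ => g : Fin (k + 1) → G) =
        f + C.shift n fun _ => c := by
      funext i
      simp only [shift, Pi.sub_apply, Pi.add_apply, hg]
      abel
    beta_reduce at h1
    rw [h2] at h1
    rw [ha]
    beta_reduce
    rw [← h1]
    set D := C.box (n + 1) (f + C.shift n fun _ => c)
    have hBm := (measurePreserving_prod hS g).measurable hB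
    have h3 := measureReal_union_add_inter (μ := C.prodMeasure (Fin (k + 1)))
      (s := B ∩ D) (t := IMP.act (IMP.powAction C.action (k + 1)) g ⁻¹' B ∩ D)
      (hBm.inter (measurableSet_box _ _))
      (ne_top_of_le_ne_top (measure_box_ne_top _ _) (measure_mono inter_subset_right))
      (ne_top_of_le_ne_top (measure_box_ne_top _ _) (measure_mono inter_subset_right))
    rw [← h3, ← union_inter_distrib_right]
    have h4 : (C.prodMeasure (Fin (k + 1))).real ((B ∩ D) ∩
        (IMP.act (IMP.powAction C.action (k + 1)) g ⁻¹' B ∩ D)) = 0 := by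
      rw [measureReal_def, measure_mono_null _ hnull]
      · rfl
      · exact fun x hx => ⟨hx.2.1, hx.1.1⟩
    rw [h4, add_zero]
    exact measureReal_inter_box_le _ _ _
  have hbound := le_half_of_sum_le (sh := fun n => C.shift (ι := Fin (k + 1)) n)
    (fun n => Finset.univ.image fun c _ => c)
    (W := C.boxMeasure (Fin (k + 1))) (φ := a) card_mul_boxMeasure
    (fun n f => (measure_inter_box B hB n f).le) (measureReal_inter_box_le B)
    (fun n f => by
      rw [Finset.sum_image (hdiag n).injOn, Finset.card_image_of_injective _ (hdiag n)]
      have hM : 2 ≤ C.M n := by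
        have := hC.two_mul_le n
        omega
      obtain ⟨m, hm⟩ : ∃ m, C.M n = m + 2 := ⟨C.M n - 2, by omega⟩
      -- Pairing each letter with the next one in a cycle, every letter is counted twice.
      let σ : Equiv.Perm (Fin (C.M n)) := finRotate (C.M n)
      have hσ : ∀ c, c ≠ σ c := by
        intro c h
        have h1 : c ∈ (finRotate (C.M n)).support := by
          rw [support_finRotate_of_le hM]
          exact Finset.mem_univ c
        exact Equiv.Perm.mem_support.1 h1 h.symm
      have h1 := Finset.sum_le_sum fun c (_ : c ∈ Finset.univ) => hpair n f c (σ c) (hσ c)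
      rw [Finset.sum_add_distrib, Equiv.sum_comp σ fun c => a (n + 1) (f + C.shift n fun _ => c),
        Finset.sum_const, nsmul_eq_mul] at h1
      linarith)
    (fun hsum => hC.not_summable 0 (((hsum.congr fun n => by
      rw [Finset.card_image_of_injective _ (hdiag n)]
      have hM : (C.M n : ℝ) ≠ 0 := by exact_mod_cast (C.pos n).ne'
      simp only [Finset.card_univ, Fintype.card_fin, Fintype.card_pi, Finset.prod_const]
      push_cast
      rw [pow_succ, div_mul_cancel_right₀ hM] : Summable fun n =>
        ((C.M n : ℝ) ^ k)⁻¹)).indicator _)) n f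
  have h2 := boxMeasure_pos (C := C) (ι := Fin (k + 1)) n
  change 3 / 4 * _ < a n f at hf
  linarith

end CFSeq

/-! ### Union bounds along a tree -/

section Reach

variable {A : Type*} [Add A] {L : ℕ → Type*} [∀ n, Fintype (L n)]

open Classical in
/-- The vertices reached from `f` at level `n` after `t` steps. -/
noncomputable def reach (sh : ∀ n, L n → A) (n : ℕ) (f : A) : ℕ → Finset A
  | 0 => {f}
  | t + 1 => (reach sh n f t ×ˢ Finset.univ).image fun q => q.1 + sh (n + t) q.2

variable {sh : ∀ n, L n → A}

theorem card_reach_mul_le {W : ℕ → ENNReal} (hW : ∀ n, Fintype.card (L n) * W (n + 1) = W n)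
    (n : ℕ) (f : A) (t : ℕ) : (reach sh n f t).card * W (n + t) ≤ W n := by
  classical
  induction t with
  | zero => simp [reach]
  | succ t ih =>
    refine le_trans ?_ ih
    rw [← hW (n + t), ← mul_assoc, ← add_assoc]
    gcongr
    rw [← Nat.cast_mul]
    gcongr
    exact Finset.card_image_le.trans (by rw [Finset.card_product, Finset.card_univ])

/-- Each reached vertex has `Z.card` of its children in the union, and the reached vertices have
total weight at most `W n`: the union takes at most the frequency of `Z`. -/
theorem measure_reach_mul_le {Y : Type*} [MeasurableSpace Y] {ν : Measure Y} {Q : ℕ → A → Set Y}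
    {W : ℕ → ENNReal} (hW : ∀ n, Fintype.card (L n) * W (n + 1) = W n)
    (hν : ∀ n f, ν (Q n f) ≤ W n) (n : ℕ) (f : A) (t : ℕ) (Z : Finset (L (n + t))) :
    ν (⋃ p ∈ reach sh n f t, ⋃ j ∈ Z, Q (n + t + 1) (p + sh (n + t) j)) *
      Fintype.card (L (n + t)) ≤ Z.card * W n := by
  have h1 : ν (⋃ p ∈ reach sh n f t, ⋃ j ∈ Z, Q (n + t + 1) (p + sh (n + t) j)) ≤
      (reach sh n f t).card * (Z.card * W (n + t + 1)) := by
    refine (measure_biUnion_finset_le _ _).trans ?_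
    rw [← nsmul_eq_mul]
    refine Finset.sum_le_card_nsmul _ _ _ fun p _ => ?_
    refine (measure_biUnion_finset_le _ _).trans ?_
    rw [← nsmul_eq_mul]
    exact Finset.sum_le_card_nsmul _ _ _ fun j _ => hν _ _
  calc _ ≤ (reach sh n f t).card * (Z.card * W (n + t + 1)) * Fintype.card (L (n + t)) := by gcongr
    _ = Z.card * ((reach sh n f t).card * (Fintype.card (L (n + t)) * W (n + t + 1))) := by ring
    _ ≤ Z.card * W n := by
      rw [hW (n + t)]
      gcongr
      exact card_reach_mul_le hW n f t

theorem mem_reach {n : ℕ} {ω : ℕ → A} {c : ∀ n, L n}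
    (h : ∀ l ≥ n, ω (l + 1) = ω l + sh l (c l)) (t : ℕ) : ω (n + t) ∈ reach sh n (ω n) t := by
  classical
  induction t with
  | zero => simp [reach]
  | succ t ih =>
    rw [← add_assoc, h (n + t) (by omega)]
    exact Finset.mem_image.2 ⟨(ω (n + t), c (n + t)), by simpa using ih, rfl⟩

end Reach

/-! ### Descent through the towers and sets avoiding rare words -/

namespace CFSeq

variable {G : Type*} [AddCommGroup G] {C : CFSeq G}

theorem exists_letters {x : C.Space} {n : ℕ} {f : G} (hf : f ∈ C.F n) (hx : x ∈ C.level n f) :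
    ∃ (ω : ℕ → G) (c : ∀ n, Fin (C.M n)), ω n = f ∧ (∀ l ≥ n, ω (l + 1) = ω l + C.e l (c l)) ∧
      (∀ l ≥ n, ω l ∈ C.F l) ∧ (∀ l ≥ n, x ∈ C.level l (ω l)) ∧ ∀ l ≥ n, x.1 l = some (ω l) := by
  rw [mem_level_iff hf] at hx
  obtain ⟨ω, hω, hωn, hωx⟩ := exists_path x hx
  have hmem := hω.mem (by rwa [hωn])
  have : ∀ l, ∃ j, l ≥ n → ω (l + 1) = ω l + C.e l j := fun l => by
    by_cases hl : l ≥ n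
    · obtain ⟨j, hj⟩ := hω l hl
      exact ⟨j, fun _ => hj⟩
    · exact ⟨⟨0, C.pos l⟩, fun h => (hl h).elim⟩
  choose c hc using this
  exact ⟨ω, c, hωn, hc, hmem, fun l hl => (mem_level_iff (hmem l hl)).2 (hωx l hl), hωx⟩

theorem eventually_sub_eq {x : C.Space} {g : G} {n : ℕ} {ω ω' : ℕ → G}
    (h : ∀ l ≥ n, x.1 l = some (ω l)) (h' : ∀ l ≥ n, (IMP.act C.action g x).1 l = some (ω' l)) :
    ∀ᶠ l in atTop, ω' l - ω l = g := by
  filter_upwards [act_eventually g x, eventually_ge_atTop n] with l h1 h2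
  rw [h l h2, h' l h2] at h1
  simp only [Option.map_some, Option.some.injEq] at h1
  rw [h1, add_sub_cancel_right]

section Descent

variable {k : ℕ} {ι : Type*}

/-- If two tuples of cells differ by a common translation, then either the letters of the tuples
agree, or they are all changed in the same way, or they are all special. -/
theorem letters_trichotomy {l : ℕ} (hC : IsSparse k (C.F l) (C.e l)) {p q : ι → G}
    (hp : ∀ i, p i ∈ C.F l) (hq : ∀ i, q i ∈ C.F l) {c d : ι → Fin (C.M l)} {t : G}
    (h : ∀ i, q i + C.e l (d i) - (p i + C.e l (c i)) = t) :
    (∀ i, c i = d i) ∨ (∀ i i', c i = c i' ∧ d i = d i') ∨ ∀ i, (c i : ℕ) < 2 * k := by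
  have key : ∀ i i', (c i = d i ∧ c i' = d i') ∨ (c i = c i' ∧ d i = d i') ∨
      ((c i : ℕ) < 2 * k ∧ (c i' : ℕ) < 2 * k ∧ c i ≠ d i ∧ c i' ≠ d i') := by
    intro i i'
    refine hC _ (hp i) _ (hq i) _ (hp i') _ (hq i') _ _ _ _ ?_
    rw [← add_sub_add_comm, ← add_sub_add_comm, h, h]
  by_cases h1 : ∀ i, c i = d i
  · exact Or.inl h1
  push Not at h1
  obtain ⟨i₀, h0⟩ := h1
  -- At the coordinate `i₀` the letter changes. Comparison with `i₀` makes all the letters special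
  -- if this one is, and otherwise makes every coordinate copy it.
  by_cases h2 : (c i₀ : ℕ) < 2 * k
  · refine Or.inr (Or.inr fun i => ?_)
    rcases key i i₀ with h3 | h3 | h3
    · exact (h0 h3.2).elim
    · rw [h3.1]
      exact h2
    · exact h3.1
  · have h3 : ∀ i, c i = c i₀ ∧ d i = d i₀ := fun i => by
      rcases key i i₀ with h3 | h3 | h3
      · exact (h0 h3.2).elim
      · exact h3
      · exact (h2 h3.2.1).elim
    exact Or.inr (Or.inl fun i i' =>
      ⟨(h3 i).1.trans (h3 i').1.symm, (h3 i).2.trans (h3 i').2.symm⟩)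

variable [Fintype ι]

section

variable [DecidableEq ι]

/-- The points of a box none of whose tuples of letters is in `Z`. -/
def goodSet (Z : ∀ n, Finset (ι → Fin (C.M n))) (n : ℕ) (f : ι → G) : Set (ι → C.Space) :=
  C.box n f \ ⋃ t, ⋃ p ∈ reach (C.shift (ι := ι)) n f t, ⋃ j ∈ Z (n + t),
    C.box (n + t + 1) (p + C.shift (n + t) j)

theorem measurableSet_goodSet (Z : ∀ n, Finset (ι → Fin (C.M n))) (n : ℕ) (f : ι → G) :
    MeasurableSet (goodSet Z n f) :=
  (measurableSet_box n f).diff (MeasurableSet.iUnion fun _ => Finset.measurableSet_biUnion _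
    fun _ _ => Finset.measurableSet_biUnion _ fun _ _ => measurableSet_box _ _)

theorem exists_letters_goodSet {Z : ∀ n, Finset (ι → Fin (C.M n))} {n : ℕ} {f : ι → G}
    (hf : ∀ i, f i ∈ C.F n) {x : ι → C.Space} (hx : x ∈ goodSet Z n f) :
    ∃ (ω : ℕ → ι → G) (c : ∀ n, ι → Fin (C.M n)), ω n = f ∧
      (∀ l ≥ n, ω (l + 1) = ω l + C.shift l (c l)) ∧ (∀ l ≥ n, ∀ i, ω l i ∈ C.F l) ∧
      (∀ l ≥ n, ∀ i, (x i).1 l = some (ω l i)) ∧ ∀ l ≥ n, c l ∉ Z l := by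
  choose ω c h1 h2 h3 h4 h5 using fun i => exists_letters (hf i) (mem_box.1 hx.1 i)
  have hstep : ∀ l ≥ n, (fun l i => ω i l) (l + 1) =
      (fun l i => ω i l) l + C.shift l (fun i => c i l) := fun l hl => funext fun i => h2 i l hl
  refine ⟨fun l i => ω i l, fun l i => c i l, funext h1, hstep, fun l hl i => h3 i l hl,
    fun l hl i => h5 i l hl, fun l hl hcl => hx.2 ?_⟩
  classical
  obtain ⟨t, rfl⟩ := Nat.exists_eq_add_of_le hl
  have hr := mem_reach (sh := C.shift (ι := ι)) (ω := fun l i => ω i l)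
    (c := fun l i => c i l) hstep t
  have hn : (fun i => ω i n) = f := funext h1
  beta_reduce at hr
  rw [hn] at hr
  refine mem_iUnion.2 ⟨t, ?_⟩
  refine mem_biUnion hr (mem_biUnion hcl ?_)
  rw [mem_box]
  intro i
  have := h4 i (n + t + 1) (by omega)
  rwa [h2 i (n + t) (by omega)] at this

/-- The first half of Borel–Cantelli, uniform over the boxes: once the tail of the frequencies is
below `1`, the deleted boxes cannot cover the box. -/
theorem eventually_goodSet_pos [Countable G] {Z : ∀ n, Finset (ι → Fin (C.M n))}
    (hZ : Summable fun n => ((Z n).card : ℝ) / Fintype.card (ι → Fin (C.M n))) :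
    ∀ᶠ n in atTop, ∀ f : ι → G, 0 < C.prodMeasure ι (goodSet Z n f) := by
  classical
  have hlim := tendsto_sum_nat_add fun n => ((Z n).card : ℝ) / Fintype.card (ι → Fin (C.M n))
  filter_upwards [hlim.eventually_lt_const one_pos] with n hn f
  set W : ℕ → ENNReal := fun n => C.width n ^ Fintype.card ι with hWdef
  have hW : ∀ n, (Fintype.card (ι → Fin (C.M n)) : ENNReal) * W (n + 1) = W n := fun n => by
    rw [hWdef]
    beta_reduce
    rw [← width_succ n, mul_pow]
    simp
  have hW0 : W n ≠ 0 := pow_ne_zero _ (width_ne_zero n)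
  have hWt : W n ≠ ⊤ := ENNReal.pow_ne_top (width_ne_top n)
  rw [pos_iff_ne_zero]
  intro h0
  have h1 := measure_reach_mul_le (sh := C.shift (ι := ι)) (Q := C.box) hW
    (fun n f => (measure_box n f).le) n f
  have h2 : ∀ t, (C.prodMeasure ι) (⋃ p ∈ reach (C.shift (ι := ι)) n f t, ⋃ j ∈ Z (n + t),
      C.box (n + t + 1) (p + C.shift (n + t) j)) ≤
      W n * ENNReal.ofReal (((Z (t + n)).card : ℝ) / Fintype.card (ι → Fin (C.M (t + n)))) := by
    intro t
    have hc : (0 : ℝ) < Fintype.card (ι → Fin (C.M (t + n))) := by exact_mod_cast Fintype.card_pos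
    rw [ENNReal.ofReal_div_of_pos hc, ENNReal.ofReal_natCast, ENNReal.ofReal_natCast, add_comm t n,
      ← mul_div_assoc, ENNReal.le_div_iff_mul_le (Or.inl (Nat.cast_ne_zero.2 Fintype.card_ne_zero))
        (Or.inl (ENNReal.natCast_ne_top _))]
    rw [mul_comm (W n)]
    exact h1 t (Z (n + t))
  have h3 : W n ≤ W n * ENNReal.ofReal
      (∑' t, ((Z (t + n)).card : ℝ) / Fintype.card (ι → Fin (C.M (t + n)))) := by
    rw [ENNReal.ofReal_tsum_of_nonneg (fun t => by positivity) ((summable_nat_add_iff n).2 hZ),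
      ← ENNReal.tsum_mul_left]
    refine le_trans ?_ (ENNReal.tsum_le_tsum h2)
    refine le_trans ?_ (measure_iUnion_le _)
    rw [← show C.prodMeasure ι (C.box n f) = W n from measure_box n f]
    rw [goodSet] at h0
    refine measure_mono_ae ?_
    have h4 := ae_le_set.2 h0
    convert h4
  have h4 : W n * ENNReal.ofReal
      (∑' t, ((Z (t + n)).card : ℝ) / Fintype.card (ι → Fin (C.M (t + n)))) < W n * 1 := by
    rw [ENNReal.mul_lt_mul_iff_right hW0 hWt]
    rwa [ENNReal.ofReal_lt_one]
  rw [mul_one] at h4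
  exact absurd h3 (not_le.2 h4)

end

end Descent

end CFSeq

/-! ### Failure of ergodicity and of conservativity -/

namespace CFSeq

variable {G : Type*} [AddCommGroup G] {C : CFSeq G}

section Words

variable {ι : Type*} [Fintype ι] [DecidableEq ι]

/-- The tuples of special letters. -/
def specialWords (C : CFSeq G) (k : ℕ) (ι : Type*) [Fintype ι] [DecidableEq ι] (n : ℕ) :
    Finset (ι → Fin (C.M n)) :=
  Fintype.piFinset fun _ => Finset.univ.filter fun j : Fin (C.M n) => (j : ℕ) < 2 * k

/-- The constant tuples. -/
def constWords (C : CFSeq G) (ι : Type*) [Fintype ι] [DecidableEq ι] (n : ℕ) :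
    Finset (ι → Fin (C.M n)) :=
  Finset.univ.image fun c _ => c

theorem mem_specialWords {k n : ℕ} {c : ι → Fin (C.M n)} :
    c ∈ C.specialWords k ι n ↔ ∀ i, (c i : ℕ) < 2 * k := by
  simp [specialWords]

theorem card_special_le (k n : ℕ) :
    (Finset.univ.filter fun j : Fin (C.M n) => (j : ℕ) < 2 * k).card ≤ 2 * k := by
  have := Finset.card_le_card_of_injOn (s := Finset.univ.filter fun j : Fin (C.M n) =>
    (j : ℕ) < 2 * k) (t := Finset.range (2 * k)) (fun j => (j : ℕ))
    (fun j hj => by simpa using hj) (fun i _ j _ h => Fin.ext h)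
  simpa using this

theorem card_specialWords_le (k n : ℕ) :
    (C.specialWords k ι n).card ≤ (2 * k) ^ Fintype.card ι := by
  rw [specialWords, Fintype.card_piFinset, Finset.prod_const, Finset.card_univ]
  exact Nat.pow_le_pow_left (card_special_le k n) _

theorem card_constWords_le (n : ℕ) : (C.constWords ι n).card ≤ C.M n :=
  Finset.card_image_le.trans (by simp)

variable {k : ℕ} {u : ℕ → Fin k → G}

theorem exists_cells_goodSet {Z : ∀ n, Finset (ι → Fin (C.M n))} {n : ℕ} {f f' : ι → G}
    (hf : ∀ i, f i ∈ C.F n) (hf' : ∀ i, f' i ∈ C.F n) {x : ι → C.Space} (hx : x ∈ goodSet Z n f)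
    {g : G} (hgx : (fun i => IMP.act C.action g (x i)) ∈ goodSet Z n f') :
    ∃ (ω ω' : ℕ → ι → G) (c d : ∀ n, ι → Fin (C.M n)), ω n = f ∧ ω' n = f' ∧
      (∀ l ≥ n, ∀ i, ω (l + 1) i = ω l i + C.e l (c l i)) ∧
      (∀ l ≥ n, ∀ i, ω' (l + 1) i = ω' l i + C.e l (d l i)) ∧
      (∀ l ≥ n, ∀ i, ω l i ∈ C.F l) ∧ (∀ l ≥ n, ∀ i, ω' l i ∈ C.F l) ∧
      (∀ l ≥ n, c l ∉ Z l) ∧ ∃ N ≥ n, ∀ i, ω' N i - ω N i = g := by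
  obtain ⟨ω, c, h1, h2, h3, h4, h5⟩ := exists_letters_goodSet hf hx
  obtain ⟨ω', d, h1', h2', h3', h4', h5'⟩ := exists_letters_goodSet hf' hgx
  have hev : ∀ᶠ l in atTop, ∀ i, ω' l i - ω l i = g :=
    eventually_all.2 fun i => eventually_sub_eq (fun l hl => h4 l hl i) (fun l hl => h4' l hl i)
  obtain ⟨N, hN, hNn⟩ := (hev.and (eventually_ge_atTop n)).exists
  exact ⟨ω, ω', c, d, h1, h1', fun l hl i => congrFun (h2 l hl) i,
    fun l hl i => congrFun (h2' l hl) i, h3, h3', h5, N, hNn, hN⟩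

/-- At a late level all the coordinates differ by `g`. Descending, equal letters keep the difference
and constant words change it by the same amount in all the coordinates; special words, the only
obstruction, have been deleted. -/
theorem sub_eq_sub_of_goodSet [Nonempty ι] (hC : IsAdmissible C k u) {n : ℕ} {f f' : ι → G}
    (hf : ∀ i, f i ∈ C.F n) (hf' : ∀ i, f' i ∈ C.F n) {x : ι → C.Space} {g : G}
    (hx : x ∈ goodSet (C.specialWords k ι) n f)
    (hgx : (fun i => IMP.act C.action g (x i)) ∈ goodSet (C.specialWords k ι) n f') (i i' : ι) :
    f' i - f i = f' i' - f i' := by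
  obtain ⟨ω, ω', c, d, h1, h1', h2, h2', h3, h3', h4, N, hN, hNg⟩ :=
    exists_cells_goodSet hf hf' hx hgx
  have key := Nat.decreasingInduction' (P := fun l => ∃ t, ∀ i, ω' l i - ω l i = t) (m := n)
    (n := N) (fun l _ hl ⟨t, ht⟩ => by
      have ht' : ∀ i, ω' l i + C.e l (d l i) - (ω l i + C.e l (c l i)) = t := fun i => by
        rw [← h2 l hl i, ← h2' l hl i, ht]
      rcases letters_trichotomy (hC.sparse l) (h3 l hl) (h3' l hl) ht' with h | h | h
      · exact ⟨t, fun i => by rw [← ht' i, h i]; abel⟩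
      · obtain ⟨i₀⟩ := ‹Nonempty ι›
        refine ⟨t - C.e l (d l i₀) + C.e l (c l i₀), fun i => ?_⟩
        rw [← ht' i, (h i i₀).1, (h i i₀).2]
        abel
      · exact (h4 l hl (mem_specialWords.2 h)).elim) hN ⟨g, hNg⟩
  obtain ⟨t, ht⟩ := key
  rw [h1, h1'] at ht
  rw [ht, ht]

/-- The same descent with the constant words deleted too: only equal letters remain, so the
difference is `g` down to level `n`. -/
theorem sub_eq_of_goodSet (hC : IsAdmissible C k u) {n : ℕ} {f f' : ι → G} [Nonempty ι]
    (hf : ∀ i, f i ∈ C.F n) (hf' : ∀ i, f' i ∈ C.F n) {x : ι → C.Space} {g : G}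
    (hx : x ∈ goodSet (fun n => C.specialWords k ι n ∪ C.constWords ι n) n f)
    (hgx : (fun i => IMP.act C.action g (x i)) ∈
      goodSet (fun n => C.specialWords k ι n ∪ C.constWords ι n) n f') (i : ι) :
    f' i - f i = g := by
  obtain ⟨ω, ω', c, d, h1, h1', h2, h2', h3, h3', h4, N, hN, hNg⟩ :=
    exists_cells_goodSet hf hf' hx hgx
  have key := Nat.decreasingInduction' (P := fun l => ∀ i, ω' l i - ω l i = g) (m := n)
    (n := N) (fun l _ hl ht => by
      have ht' : ∀ i, ω' l i + C.e l (d l i) - (ω l i + C.e l (c l i)) = g := fun i => by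
        rw [← h2 l hl i, ← h2' l hl i, ht]
      have hcl := h4 l hl
      rw [Finset.mem_union, not_or] at hcl
      rcases letters_trichotomy (hC.sparse l) (h3 l hl) (h3' l hl) ht' with h | h | h
      · exact fun i => by rw [← ht' i, h i]; abel
      · obtain ⟨i₀⟩ := ‹Nonempty ι›
        refine (hcl.2 (Finset.mem_image.2 ⟨c l i₀, Finset.mem_univ _, ?_⟩)).elim
        exact funext fun i => (h i₀ i).1
      · exact (hcl.1 (mem_specialWords.2 h)).elim) hN hNg
  rw [h1, h1'] at key
  exact key i

end Words

variable {k : ℕ} {u : ℕ → Fin k → G}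

theorem exists_ne_zero_mem (hC : IsAdmissible C k u) {n : ℕ} (hn : 2 ≤ n) :
    ∃ a ∈ C.F n, a ≠ 0 := by
  apply Finset.exists_mem_ne
  have h1 := hC.card_le n
  have h2 : 0 < ∏ l ∈ Finset.range n, C.M l := Finset.prod_pos fun l _ => C.pos l
  nlinarith

theorem act_image_level (g : G) (n : ℕ) (f : G) :
    IMP.act C.action g '' C.level n f = C.level n (f + g) := by
  ext x
  rw [act_image_eq_preimage, mem_preimage, act_mem_level_iff, sub_neg_eq_add]

variable [Countable G]

/-- The orbit of the good part of the box at `0` misses the good part of the box at `(a, 0, …, 0)`,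
since orbits keep the differences of the coordinates. Both parts have positive measure, because
boundedly many special words out of `M n ^ (k + 1)` are summable. -/
theorem not_isErgodic_of_isAdmissible (hk : 0 < k) (hC : IsAdmissible C k u) :
    ¬ IMP.IsErgodic (IMP.powAction C.action (k + 1)) (IMP.powMeasure C.measure (k + 1)) := by
  intro herg
  have hZ : Summable fun n => ((C.specialWords k (Fin (k + 1)) n).card : ℝ) /
      Fintype.card (Fin (k + 1) → Fin (C.M n)) := by
    refine (hC.summable.mul_left ((2 * k : ℝ) ^ (k + 1))).of_nonneg_of_le
      (fun n => by positivity) fun n => ?_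
    have h1 : ((C.specialWords k (Fin (k + 1)) n).card : ℝ) ≤ (2 * k : ℝ) ^ (k + 1) := by
      have := C.card_specialWords_le (ι := Fin (k + 1)) k n
      rw [Fintype.card_fin] at this
      exact_mod_cast this
    rw [div_eq_mul_inv]
    simp only [Fintype.card_pi, Fintype.card_fin, Finset.prod_const, Finset.card_univ,
      Nat.cast_pow]
    gcongr
  obtain ⟨n, hn, hn2⟩ := ((eventually_goodSet_pos hZ).and (eventually_ge_atTop 2)).exists
  obtain ⟨a, ha, ha0⟩ := exists_ne_zero_mem hC hn2
  set W : (Fin (k + 1) → G) → Set (Fin (k + 1) → C.Space) :=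
    goodSet (C.specialWords k (Fin (k + 1))) n
  set S := IMP.powAction C.action (k + 1)
  have hS : ∀ g x i, IMP.act S g x i =
      IMP.act C.action ((fun g _ => g : G → Fin (k + 1) → G) g i) (x i) := fun _ _ _ => rfl
  set A := ⋃ g, IMP.act S g ⁻¹' W 0 with hA
  have hAm : MeasurableSet A := MeasurableSet.iUnion fun g =>
    (measurePreserving_prod hS g).measurable (measurableSet_goodSet _ _ _)
  have hinv : ∀ g, IMP.act S g ⁻¹' A = A := by
    intro g
    ext x
    simp only [hA, mem_preimage, mem_iUnion, ← IMP.act_add]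
    exact ⟨fun ⟨h, hx⟩ => ⟨h + g, hx⟩, fun ⟨h, hx⟩ => ⟨h - g, by rwa [sub_add_cancel]⟩⟩
  have hconst := @ErgodicVAdd.aeconst_of_forall_preimage_vadd_ae_eq G _ S.toVAdd _ _ herg A hAm
    (fun g => Filter.EventuallyEq.of_eq (hinv g))
  change EventuallyConst A (ae (C.prodMeasure (Fin (k + 1)))) at hconst
  rw [eventuallyConst_set', ae_eq_empty, ae_eq_univ] at hconst
  rcases hconst with h | h
  · refine (hn 0).ne' (measure_mono_null ?_ h)
    intro x hx
    refine mem_iUnion.2 ⟨0, ?_⟩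
    rwa [mem_preimage, IMP.act_zero]
  · refine (hn (Pi.single 0 a)).ne' (measure_mono_null ?_ h)
    intro x hx hxA
    obtain ⟨g, hg⟩ := mem_iUnion.1 hxA
    have hmem : ∀ i, (Pi.single 0 a : Fin (k + 1) → G) i ∈ C.F n := by
      intro i
      rcases eq_or_ne i 0 with rfl | hi
      · simpa using ha
      · simpa [hi] using C.zero_mem n
    have h1 := sub_eq_sub_of_goodSet hC hmem (fun i => C.zero_mem n) hx hg 0 (Fin.last k)
    have h2 : Fin.last k ≠ 0 := by
      simpa [Fin.ext_iff] using hk.ne'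
    simp [h2] at h1
    exact ha0 h1

/-- The good part of the box at `0` is wandering: a return under `g` forces `g = 0 - 0`. -/
theorem not_isConservative_of_isAdmissible (hC : IsAdmissible C k u) :
    ¬ IMP.IsConservative (IMP.powAction C.action (k + 2)) (IMP.powMeasure C.measure (k + 2)) := by
  intro hcons
  have hZ : Summable fun n => ((C.specialWords k (Fin (k + 2)) n ∪
      C.constWords (Fin (k + 2)) n).card : ℝ) / Fintype.card (Fin (k + 2) → Fin (C.M n)) := by
    refine (hC.summable.mul_left ((2 * k : ℝ) ^ (k + 2) + 1)).of_nonneg_of_le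
      (fun n => by positivity) fun n => ?_
    have h0 : (1 : ℝ) ≤ C.M n := by exact_mod_cast C.pos n
    have h1 : ((C.specialWords k (Fin (k + 2)) n ∪ C.constWords (Fin (k + 2)) n).card : ℝ) ≤
        (2 * k : ℝ) ^ (k + 2) + C.M n := by
      have := C.card_specialWords_le (ι := Fin (k + 2)) k n
      rw [Fintype.card_fin] at this
      exact_mod_cast (Finset.card_union_le _ _).trans (add_le_add this (C.card_constWords_le n))
    have h2 : (2 * k : ℝ) ^ (k + 2) + C.M n ≤ ((2 * k : ℝ) ^ (k + 2) + 1) * C.M n := by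
      have : (0 : ℝ) ≤ (2 * k : ℝ) ^ (k + 2) := by positivity
      nlinarith
    simp only [Fintype.card_pi, Fintype.card_fin, Finset.prod_const, Finset.card_univ,
      Nat.cast_pow]
    rw [div_le_iff₀ (by positivity), pow_succ (C.M n : ℝ) (k + 1), mul_assoc,
      inv_mul_cancel_left₀ (by positivity)]
    exact h1.trans h2
  obtain ⟨n, hn⟩ := (eventually_goodSet_pos hZ).exists
  obtain ⟨g, hg, hpos⟩ := hcons _ (measurableSet_goodSet _ n 0) (hn 0)
  obtain ⟨_, ⟨x, hx, rfl⟩, hgx⟩ := nonempty_of_measure_ne_zero hpos.ne'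
  have := sub_eq_of_goodSet hC (fun i => C.zero_mem n) (fun i => C.zero_mem n) hx hgx 0
  simp at this
  exact hg this.symm

theorem measure_univ_of_isAdmissible (hC : IsAdmissible C k u) : C.measure univ = ⊤ := by
  refine ENNReal.eq_top_of_forall_nnreal_le fun r => ?_
  obtain ⟨n, hn⟩ := exists_nat_ge r
  have h1 : (n : ENNReal) ≤ C.measure (⋃ f ∈ C.F n, C.level n f) := by
    rw [measure_biUnion_finset (fun p hp q hq hpq => disjoint_level hp hq hpq)
      (fun f _ => measurableSet_level n f)]
    simp only [measure_level, Finset.sum_const, nsmul_eq_mul]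
    have h2 : (n : ENNReal) = (n * ∏ l ∈ Finset.range n, C.M l : ℕ) * C.width n := by
      rw [Nat.cast_mul, mul_assoc, width, Nat.cast_prod, ← Finset.prod_mul_distrib]
      rw [Finset.prod_eq_one, mul_one]
      intro l _
      exact ENNReal.mul_inv_cancel (by exact_mod_cast (C.pos l).ne') (ENNReal.natCast_ne_top _)
    rw [h2]
    gcongr
    exact hC.card_le n
  refine le_trans ?_ (h1.trans (measure_mono (subset_univ _)))
  exact_mod_cast hn

/-! ### Funny rank one and zero type -/

theorem isFunnyRankOneAlong : IMP.IsFunnyRankOneAlong C.action C.measure C.F := by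
  refine ⟨fun n => C.level n 0, fun n => ⟨measurableSet_level n 0, ?_⟩, fun n g hg h hh hgh => ?_,
    fun B hB hB' ε hε => ?_⟩
  · rw [measure_level]
    exact (width_ne_top n).lt_top
  · simp only [act_image_level, zero_add]
    exact disjoint_level hg hh hgh
  · simpa only [act_image_level, zero_add] using
      isRefiningSeq_level.eventually_exists_symmDiff_lt hB hB'.ne hε

theorem measure_inter_preimage_level_le (hC : IsAdmissible C k u) {n N : ℕ} (hnN : n ≤ N)
    {f f' : G} (hf : f ∈ C.F n) (hf' : f' ∈ C.F n) {g : G}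
    (hg : ∀ p ∈ C.F N, ∀ q ∈ C.F N, q - p ≠ g) {R : ℕ} (hR : ∀ m ≥ N, R ≤ C.M m) :
    C.measure (C.level n f ∩ IMP.act C.action g ⁻¹' C.level n f') * R ≤
      (2 * k + 1 : ℕ) * C.width n := by
  classical
  have hstep : ∀ x ∈ C.level n f ∩ IMP.act C.action g ⁻¹' C.level n f',
      ∃ m ≥ N, ∃ (ω : ℕ → G) (c : ∀ n, Fin (C.M n)) (d : Fin (C.M m)), ω n = f ∧
        (∀ l ≥ n, ω (l + 1) = ω l + C.e l (c l)) ∧ x ∈ C.level (m + 1) (ω (m + 1)) ∧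
        ω m ∈ C.F m ∧ c m ≠ d ∧ (∃ q ∈ C.F m, g = q - ω m + (C.e m d - C.e m (c m))) ∧
        ∃ p ∈ C.F (m + 1), ∃ q ∈ C.F (m + 1), g = q - p := by
    rintro x ⟨hx, hgx⟩
    obtain ⟨ω, c, h1, h2, h3, h4, h5⟩ := exists_letters hf hx
    obtain ⟨ω', d, h1', h2', h3', h4', h5'⟩ := exists_letters hf' hgx
    -- The first level from `N` on where the cells differ by `g` is not `N`, hence is some `m + 1`,
    -- and the letters at `m` differ by minimality.
    have hex : ∃ l, N ≤ l ∧ ω' l - ω l = g :=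
      ((eventually_ge_atTop N).and (eventually_sub_eq h5 h5')).exists
    obtain ⟨hl1, hl2⟩ := Nat.find_spec hex
    have hmin := fun m => Nat.find_min hex (m := m)
    generalize Nat.find hex = l at hl1 hl2 hmin
    have hlN : l ≠ N := by
      rintro rfl
      exact hg _ (h3 l hnN) _ (h3' l hnN) hl2
    obtain ⟨m, rfl⟩ : ∃ m, l = m + 1 := ⟨l - 1, by omega⟩
    have hg' : g = ω' m - ω m + (C.e m (d m) - C.e m (c m)) := by
      rw [← hl2, h2 m (by omega), h2' m (by omega)]
      abel
    refine ⟨m, by omega, ω, c, d m, h1, h2, h4 (m + 1) (by omega), h3 m (by omega), ?_,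
      ⟨ω' m, h3' m (by omega), hg'⟩, ω (m + 1), h3 _ (by omega), ω' (m + 1), h3' _ (by omega),
      hl2.symm⟩
    intro hcd
    refine hmin m (by omega) ⟨by omega, ?_⟩
    rw [hg', hcd, sub_self, add_zero]
  rcases (C.level n f ∩ IMP.act C.action g ⁻¹' C.level n f').eq_empty_or_nonempty with h0 | ⟨x₀, hx₀⟩
  · rw [h0, measure_empty, zero_mul]
    exact zero_le
  obtain ⟨m, hmN, ω₀, c₀, d₀, -, -, -, hω₀, hcd₀, ⟨q₀, hq₀, hg₀⟩, p₁, hp₁, q₁, hq₁, hg₁⟩ :=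
    hstep x₀ hx₀
  obtain ⟨t, rfl⟩ := Nat.exists_eq_add_of_le (hnN.trans hmN)
  -- One point `x₀` of the overlap fixes the step and the letter; all the other points use the same
  -- letter or a special one.
  set Z : Finset (Fin (C.M (n + t))) :=
    insert (c₀ (n + t)) (Finset.univ.filter fun j => (j : ℕ) < 2 * k) with hZ
  have hmono : Monotone C.F := monotone_nat_of_le_succ hC.mono
  -- The step does not depend on the point: a difference of elements of `F (m + 1)` cannot involve
  -- two distinct letters at a later step, by sparseness against equal letters.
  have hlt : ∀ (m m' : ℕ), (∃ p ∈ C.F (m + 1), ∃ q ∈ C.F (m + 1), g = q - p) →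
      (∃ p ∈ C.F m', ∃ q ∈ C.F m', ∃ c d, c ≠ d ∧ g = q - p + (C.e m' d - C.e m' c)) →
      m' ≤ m := by
    rintro m m' ⟨p, hp, q, hq, hpq⟩ ⟨p', hp', q', hq', c, d, hcd, hpq'⟩
    by_contra! hlt
    have := hC.sparse m' p (hmono hlt hp) q (hmono hlt hq) p' hp' q' hq' c c c d
      (by rw [sub_self, add_zero, ← hpq, ← hpq'])
    tauto
  have hsub : C.level n f ∩ IMP.act C.action g ⁻¹' C.level n f' ⊆
      ⋃ p ∈ reach C.e n f t, ⋃ j ∈ Z, C.level (n + t + 1) (p + C.e (n + t) j) := by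
    intro x hx
    obtain ⟨m', hm'N, ω, c, d, hωn, hω, hxω, hωF, hcd, ⟨q, hq, hgq⟩, hdiff⟩ := hstep x hx
    obtain rfl : m' = n + t := le_antisymm
      (hlt _ _ ⟨p₁, hp₁, q₁, hq₁, hg₁⟩ ⟨_, hωF, q, hq, _, _, hcd, hgq⟩)
      (hlt _ _ hdiff ⟨_, hω₀, q₀, hq₀, _, _, hcd₀, hg₀⟩)
    have hr := mem_reach hω t
    rw [hωn] at hr
    refine mem_biUnion hr (mem_biUnion (?_ : c (n + t) ∈ Z) ?_)
    · rcases hC.sparse _ _ hωF _ hq _ hω₀ _ hq₀ _ _ _ _ (hgq.symm.trans hg₀) with h | h | h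
      · exact (hcd h.1).elim
      · rw [h.1]
        exact Finset.mem_insert_self _ _
      · exact Finset.mem_insert_of_mem (by simpa using h.1)
    · rwa [hω _ (by omega)] at hxω
  have hZc : Z.card ≤ 2 * k + 1 :=
    (Finset.card_insert_le _ _).trans (Nat.succ_le_succ (card_special_le k _))
  have hbound := measure_reach_mul_le (sh := C.e) (Q := C.level) (W := C.width)
    (fun n => by rw [Fintype.card_fin]; exact width_succ n) (fun n f => (measure_level n f).le)
    n f t Z
  rw [Fintype.card_fin] at hbound
  calc _ ≤ C.measure (⋃ p ∈ reach C.e n f t, ⋃ j ∈ Z, C.level (n + t + 1) (p + C.e (n + t) j)) *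
        C.M (n + t) := by
        gcongr
        exact hR _ hmN
    _ ≤ Z.card * C.width n := hbound
    _ ≤ _ := by gcongr

theorem tendsto_measure_inter_preimage_level (hC : IsAdmissible C k u) {n : ℕ} {f f' : G}
    (hf : f ∈ C.F n) (hf' : f' ∈ C.F n) :
    Tendsto (fun g => C.measure (C.level n f ∩ IMP.act C.action g ⁻¹' C.level n f')) cofinite
      (𝓝 0) := by
  classical
  rw [ENNReal.tendsto_nhds_zero]
  intro ε hε
  have hfin : ((2 * k + 1 : ℕ) * C.width n : ENNReal) ≠ ⊤ :=
    ENNReal.mul_ne_top (ENNReal.natCast_ne_top _) (width_ne_top n)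
  obtain ⟨R, hR0, hR⟩ := ENNReal.exists_nat_pos_mul_gt hε.ne' hfin
  obtain ⟨N, hN⟩ := eventually_atTop.1 (hC.tendsto.eventually_ge_atTop R)
  have hcof : ∀ᶠ g in cofinite, g ∉ (C.F (max n N) ×ˢ C.F (max n N)).image fun t => t.2 - t.1 :=
    (Finset.finite_toSet _).eventually_cofinite_notMem
  filter_upwards [hcof] with g hg
  have h1 := measure_inter_preimage_level_le hC (le_max_left n N) hf hf' (g := g)
    (fun p hp q hq hpq => hg (Finset.mem_image.2 ⟨(p, q), by simp [hp, hq], hpq⟩))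
    (fun m hm => hN m ((le_max_right n N).trans hm))
  have hR0' : (R : ENNReal) ≠ 0 := by exact_mod_cast hR0.ne'
  rw [← ENNReal.mul_le_mul_iff_left hR0' (ENNReal.natCast_ne_top R)]
  refine h1.trans (hR.le.trans ?_)
  rw [mul_comm]

/-- Up to a small part, `A` lies in one tower; the overlap of the tower with its translate is a
finite sum of overlaps of levels. -/
theorem isZeroType_of_isAdmissible (hC : IsAdmissible C k u) :
    IMP.IsZeroType C.action C.measure := by
  classical
  intro A hA hA'
  rw [ENNReal.tendsto_nhds_zero]
  intro ε hε
  have hε3 : 0 < ε / 3 := ENNReal.div_pos hε.ne' (by simp)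
  obtain ⟨n, hn⟩ :=
    ((isRefiningSeq_level.tendsto_measure_sdiff hA hA'.ne).eventually_lt_const hε3).exists
  set V := ⋃ f ∈ C.F n, C.level n f with hV
  have hsum : Tendsto (fun g => ∑ f ∈ C.F n, ∑ f' ∈ C.F n,
      C.measure (C.level n f ∩ IMP.act C.action g ⁻¹' C.level n f')) cofinite (𝓝 0) := by
    rw [show (0 : ENNReal) = ∑ f ∈ C.F n, ∑ f' ∈ C.F n, 0 by simp]
    exact tendsto_finsetSum _ fun f hf => tendsto_finsetSum _ fun f' hf' =>
      tendsto_measure_inter_preimage_level hC hf hf'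
  have hneg : Tendsto (fun g : G => -g) cofinite cofinite := neg_injective.tendsto_cofinite
  filter_upwards [ENNReal.tendsto_nhds_zero.1 (hsum.comp hneg) _ hε3] with g hg
  rw [act_image_eq_preimage]
  set τ := IMP.act C.action (-g) with hτ
  have hmp := isMeasurePreserving_action (C := C) (-g)
  have hVm : MeasurableSet V := Finset.measurableSet_biUnion _ fun f _ => measurableSet_level n f
  have hsub : τ ⁻¹' A ∩ A ⊆ (⋃ f ∈ C.F n, ⋃ f' ∈ C.F n, C.level n f ∩ τ ⁻¹' C.level n f') ∪
      τ ⁻¹' (A \ V) ∪ (A \ V) := by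
    rintro x ⟨h1, h2⟩
    by_cases h3 : x ∈ V
    · by_cases h4 : τ x ∈ V
      · refine Or.inl (Or.inl ?_)
        obtain ⟨f, hf, hxf⟩ := mem_iUnion₂.1 h3
        obtain ⟨f', hf', hxf'⟩ := mem_iUnion₂.1 h4
        exact mem_biUnion hf (mem_biUnion hf' ⟨hxf, hxf'⟩)
      · exact Or.inl (Or.inr ⟨h1, h4⟩)
    · exact Or.inr ⟨h2, h3⟩
  calc C.measure (τ ⁻¹' A ∩ A) ≤ ε / 3 + ε / 3 + ε / 3 := by
        refine (measure_mono hsub).trans ((measure_union_le _ _).trans (add_le_add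
          ((measure_union_le _ _).trans (add_le_add ?_ ?_)) hn.le))
        · refine le_trans ((measure_biUnion_finset_le _ _).trans
            (Finset.sum_le_sum fun f _ => measure_biUnion_finset_le _ _)) hg
        · rw [hmp.measure_preimage (hA.diff hVm).nullMeasurableSet]
          exact hn.le
    _ = ε := ENNReal.add_thirds ε

end CFSeq

/-! ### Transfer along isomorphisms and conclusion -/

section Transfer

variable {G H X : Type*} [AddCommGroup G] [AddCommGroup H]

theorem act_prodAction_eq {ι : Type*} {T : ι → AddAction H X} {T' : ι → AddAction G X} {e : G ≃+ H}
    (hT : ∀ i g, IMP.act (T' i) g = IMP.act (T i) (e g)) (g : G) :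
    IMP.act (IMP.prodAction T') g = IMP.act (IMP.prodAction T) (e g) := by
  funext x i
  exact congrFun (hT i g) (x i)

variable {T : AddAction H X} {T' : AddAction G X} [MeasurableSpace X] {μ : Measure X}

theorem IMP.IsErgodic.transfer (h : IMP.IsErgodic T μ) (e : G ≃+ H)
    (hT : ∀ g, IMP.act T' g = IMP.act T (e g)) : IMP.IsErgodic T' μ := by
  have hinv := @ErgodicVAdd.toVAddInvariantMeasure H X T.toVAdd _ _ h
  refine @ErgodicVAdd.mk G _ T'.toVAdd _ _ (@VAddInvariantMeasure.mk _ _ T'.toVAdd _ _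
    fun g s hs => ?_) fun {s} hs hs' => ?_
  · have := @VAddInvariantMeasure.measure_preimage_vadd H X T.toVAdd _ _ hinv (e g) s hs
    change μ (IMP.act T (e g) ⁻¹' s) = μ s at this
    rwa [← hT] at this
  · refine @ErgodicVAdd.aeconst_of_forall_preimage_vadd_ae_eq H X T.toVAdd _ _ h s hs fun g => ?_
    have h1 : IMP.act T' (e.symm g) ⁻¹' s =ᵐ[μ] s := hs' (e.symm g)
    rwa [hT, e.apply_symm_apply] at h1

theorem IMP.IsConservative.transfer (h : IMP.IsConservative T μ) (e : G ≃+ H)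
    (hT : ∀ g, IMP.act T' g = IMP.act T (e g)) : IMP.IsConservative T' μ := by
  intro B hB hB0
  obtain ⟨g, hg, hpos⟩ := h B hB hB0
  refine ⟨e.symm g, by simpa using hg, ?_⟩
  rwa [hT, e.apply_symm_apply]

theorem IMP.IsZeroType.transfer (h : IMP.IsZeroType T μ) (e : G ≃+ H)
    (hT : ∀ g, IMP.act T' g = IMP.act T (e g)) : IMP.IsZeroType T' μ := by
  intro A hA hA'
  simp only [hT]
  exact (h A hA hA').comp e.injective.tendsto_cofinite

theorem IMP.IsFunnyRankOne.transfer (h : IMP.IsFunnyRankOne T μ) (e : G ≃+ H)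
    (hT : ∀ g, IMP.act T' g = IMP.act T (e g)) : IMP.IsFunnyRankOne T' μ := by
  obtain ⟨F, A, h1, h2, h3⟩ := h
  have hmem : ∀ n g, g ∈ (F n).map e.symm.toEquiv.toEmbedding ↔ e g ∈ F n := by
    intro n g
    simp only [Finset.mem_map_equiv]
    rfl
  refine ⟨fun n => (F n).map e.symm.toEquiv.toEmbedding, A, h1, ?_, ?_⟩
  · intro n g hg g' hg' hne
    rw [hT, hT]
    exact h2 n _ ((hmem n g).1 hg) _ ((hmem n g').1 hg') (e.injective.ne hne)
  · intro B hB hB' ε hε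
    filter_upwards [h3 B hB hB' ε hε] with n ⟨S, hS, hlt⟩
    refine ⟨S.map e.symm.toEquiv.toEmbedding, Finset.map_subset_map.2 hS, ?_⟩
    convert hlt using 4
    ext x
    simp only [mem_iUnion, Finset.mem_map, Equiv.coe_toEmbedding, exists_prop, hT]
    constructor
    · rintro ⟨_, ⟨g, hg, rfl⟩, hx⟩
      exact ⟨g, hg, by simpa using hx⟩
    · rintro ⟨g, hg, hx⟩
      exact ⟨_, ⟨g, hg, rfl⟩, by simpa using hx⟩

end Transfer

theorem exists_action_of_type_zero {H : Type} [AddCommGroup H] [Countable H] {h₀ : H}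
    (h₀' : addOrderOf h₀ = 0) {k : ℕ} (hk : 0 < k) {P : Finset H → Prop}
    (hP : ∀ S, ∃ F, P F ∧ S ⊆ F) :
    ∃ (X : Type) (_ : MeasurableSpace X) (_ : StandardBorelSpace X)
      (μ : Measure X) (_ : SigmaFinite μ) (T : AddAction H X),
      μ univ = ⊤ ∧
      IMP.IsMeasurePreserving T μ ∧
      IMP.IsZeroType T μ ∧
      (∃ F : ℕ → Finset H, (∀ n, P (F n)) ∧ IMP.IsFunnyRankOneAlong T μ F) ∧
      IMP.HasErgodicIndex T μ k ∧
      IMP.IsConservative (IMP.powAction T (k + 1)) (IMP.powMeasure μ (k + 1)) ∧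
      ¬ IMP.IsConservative (IMP.powAction T (k + 2)) (IMP.powMeasure μ (k + 2)) ∧
      ∀ m < k, IMP.IsErgodic (IMP.mixedAction T k m) (IMP.powMeasure μ k) := by
  obtain ⟨C, u, hCP, hC⟩ := exists_isAdmissible h₀' hk hP
  refine ⟨C.Space, inferInstance, inferInstance, C.measure, inferInstance, C.action,
    C.measure_univ_of_isAdmissible hC, C.isMeasurePreserving_action,
    C.isZeroType_of_isAdmissible hC, ⟨C.F, hCP, C.isFunnyRankOneAlong⟩,
    ⟨?_, C.not_isErgodic_of_isAdmissible hk hC⟩, C.isConservative_of_isAdmissible hk hC,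
    C.not_isConservative_of_isAdmissible hC, fun m _ => ?_⟩
  · exact C.isErgodic_of_isAdmissible hk hC (δ := fun g _ => g) (fun _ _ _ => rfl)
      fun i => Or.inl fun _ => rfl
  · refine C.isErgodic_of_isAdmissible hk hC (δ := fun g i => if (i : ℕ) < m then g else -g)
      (fun g x i => ?_) fun i => ?_
    · change IMP.act (if (i : ℕ) < m then C.action else IMP.invAction C.action) g (x i) = _
      split_ifs <;> rfl
    · by_cases hi : (i : ℕ) < m
      · exact Or.inl fun g => if_pos hi
      · exact Or.inr fun g => if_neg hi

theorem exists_isCube_superset {d : ℕ} (S : Finset (Fin d → ℤ)) : ∃ F, IMP.IsCube F ∧ S ⊆ F := by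
  obtain ⟨b, hb⟩ := S.bddAbove
  obtain ⟨a, ha⟩ := S.bddBelow
  -- The sum of all the extents serves as a common side length.
  refine ⟨_, ⟨a, ∑ i, (b i - a i).toNat, rfl⟩, fun x hx => ?_⟩
  rw [Finset.mem_Icc]
  refine ⟨ha hx, fun i => ?_⟩
  have h1 : x i ≤ b i := hb hx i
  have h2 : (b i - a i).toNat ≤ ∑ i, (b i - a i).toNat :=
    Finset.single_le_sum (f := fun i => (b i - a i).toNat) (fun _ _ => Nat.zero_le _)
      (Finset.mem_univ i)
  change x i ≤ a i + ((∑ i, (b i - a i).toNat : ℕ) : ℤ)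
  omega

theorem theorem0p2 (k : ℕ) (hk : 0 < k) :
    (∀ (G : Type*) [AddCommGroup G] [Countable G], (∃ g : G, addOrderOf g = 0) →
      ∃ (X : Type) (_ : MeasurableSpace X) (_ : StandardBorelSpace X)
        (μ : Measure X) (_ : SigmaFinite μ) (T : AddAction G X),
        μ univ = ⊤ ∧
        IMP.IsMeasurePreserving T μ ∧
        IMP.IsZeroType T μ ∧
        IMP.IsFunnyRankOne T μ ∧
        IMP.HasErgodicIndex T μ k ∧
        IMP.IsConservative (IMP.powAction T (k + 1)) (IMP.powMeasure μ (k + 1)) ∧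
        ¬ IMP.IsConservative (IMP.powAction T (k + 2)) (IMP.powMeasure μ (k + 2)) ∧
        ∀ m < k, IMP.IsErgodic (IMP.mixedAction T k m) (IMP.powMeasure μ k)) ∧
    (∀ d : ℕ, 0 < d →
      ∃ (X : Type) (_ : MeasurableSpace X) (_ : StandardBorelSpace X)
        (μ : Measure X) (_ : SigmaFinite μ) (T : AddAction (Fin d → ℤ) X),
        μ univ = ⊤ ∧
        IMP.IsMeasurePreserving T μ ∧
        IMP.IsZeroType T μ ∧
        IMP.IsRankOne T μ ∧
        IMP.HasErgodicIndex T μ k ∧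
        IMP.IsConservative (IMP.powAction T (k + 1)) (IMP.powMeasure μ (k + 1)) ∧
        ¬ IMP.IsConservative (IMP.powAction T (k + 2)) (IMP.powMeasure μ (k + 2)) ∧
        ∀ m < k, IMP.IsErgodic (IMP.mixedAction T k m) (IMP.powMeasure μ k)) := by
  refine ⟨fun G _ _ ⟨g, hg⟩ => ?_, fun d hd => ?_⟩
  -- The `(C, F)`-space lives in the universe of its group, so a copy of the countable group in
  -- `Type` is used.
  · let e : G ≃+ Shrink.{0} G := Shrink.addEquiv.symm
    have hcount : Countable (Shrink.{0} G) := e.symm.injective.countable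
    obtain ⟨X, i1, i2, μ, i3, T, h1, h2, h3, ⟨F, -, h4⟩, ⟨h5, h6⟩, h7, h8, h9⟩ :=
      exists_action_of_type_zero (h₀ := e g) (by rw [e.addOrderOf_eq, hg]) hk (P := fun _ => True)
        fun S => ⟨S, trivial, subset_rfl⟩
    let T' : AddAction G X :=
      { vadd := fun g x => IMP.act T (e g) x
        zero_vadd := fun x => (congrArg (IMP.act T · x) (map_zero e)).trans (IMP.act_zero T x)
        add_vadd := fun a b x =>
          (congrArg (IMP.act T · x) (map_add e a b)).trans (IMP.act_add T _ _ x) }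
    have hT : ∀ g, IMP.act T' g = IMP.act T (e g) := fun g => rfl
    have hT' : ∀ h, IMP.act T h = IMP.act T' (e.symm h) := fun h => by
      rw [hT, e.apply_symm_apply]
    refine ⟨X, i1, i2, μ, i3, T', h1, fun g => h2 (e g), h3.transfer e hT,
      IMP.IsFunnyRankOne.transfer ⟨F, h4⟩ e hT,
      ⟨h5.transfer e (act_prodAction_eq fun _ => hT),
        fun h => h6 (h.transfer e.symm (act_prodAction_eq fun _ => hT'))⟩,
      h7.transfer e (act_prodAction_eq fun _ => hT),
      fun h => h8 (h.transfer e.symm (act_prodAction_eq fun _ => hT')),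
      fun m hm => (h9 m hm).transfer e (act_prodAction_eq fun i g => ?_)⟩
    split_ifs
    · exact hT g
    · change IMP.act T (e (-g)) = IMP.act T (-e g)
      rw [map_neg]
  · obtain ⟨X, i1, i2, μ, i3, T, h1, h2, h3, h4, h5⟩ :=
      exists_action_of_type_zero (h₀ := (1 : Fin d → ℤ)) (by
        rw [addOrderOf_eq_zero_iff']
        intro n hn h
        have := congrFun h ⟨0, hd⟩
        simp at this
        omega) hk exists_isCube_superset
    exact ⟨X, i1, i2, μ, i3, T, h1, h2, h3, h4, h5⟩
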